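/- Let $u,v,w\in\mathbb{C}$ be distinct and nonzero. Let $C$ be the bielliptic curve of genus $2$ over $\mathbb{C}$ that is the smooth projective model of $y^2=(x^2-u)(x^2-v)(x^2-w)$, and let $E$ and $E'$ be the smooth projective models of $y^2=(x-u)(x-v)(x-w)$ and $y^2=x(x-u)(x-v)(x-w)$; these are the quotients of $C$ by the involutions $(x,y)\mapsto(-x,y)$ and $(x,y)\mapsto(-x,-y)$, via $\psi(x,y)=(x^2,y)$ and $\psi'(x,y)=(x^2,xy)$. Let $\pi\colon E\to\mathbb{P}^1$ and $\pi'\colon E'\to\mathbb{P}^1$ be the $x$-coordinate maps, and make $E$ and $E'$ elliptic curves by choosing as origin of each an arbitrary ramification point of $\pi$, respectively $\pi'$. Put \[ I(\pi,\pi')=\pi(E_{\mathrm{tors}})\cap\pi'(E'_{\mathrm{tors}})\subset\mathbb{P}^1, \] and let $\rho=\pi\circ\psi=\pi'\circ\psi'\colon C\to\mathbb{P}^1$, so $\rho(x,y)=x^2$. A torsion packet on $C$ is a maximal subset $T\subset C$ such that for all $P,Q\in T$ the class of $P-Q$ in the Jacobian of $C$ has finite order; the hyperelliptic torsion packet is the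 torsion packet that contains the six ramification points of the hyperelliptic double cover $C\to\mathbb{P}^1$, $(x,y)\mapsto x$. Then the hyperelliptic torsion packet of $C$ exists, is unique, and equals the full preimage $\rho^{-1}(I(\pi,\pi'))$. Its size is \[ 4\,\#I(\pi,\pi')-6-2\,\#\bigl(I(\pi,\pi')\cap\{0,\infty\}\bigr), \] as an equality of cardinalities in $\mathbb{N}\cup\{\infty\}$. -/

import Mathlib

open Polynomial

noncomputable section

namespace DoubleCover

/-- The points of the smooth projective model of `y² = f(x)` over `ℂ`, for `f` squarefree of degree
`2g+1` or `2g+2`. With `z = 1/x` and `t = y/x^(g+1)` the curve is `t² = f.coeff (2g+2) + ⋯` near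
`x = ∞`; the point `infty b` is the one with `z = 0`, `t = b`. So there is one point at infinity
(`b = 0`) if `deg f = 2g+1`, and there are two if `deg f = 2g+2`. -/
inductive Point (f : ℂ[X]) (g : ℕ) : Type
  | affine (a b : ℂ) (h : b ^ 2 = f.eval a) : Point f g
  | infty (b : ℂ) (h : b ^ 2 = f.coeff (2 * g + 2)) : Point f g

/-- The function field `ℂ(x)(y)`, `y² = f(x)`; here `y` is `QuadraticAlgebra.omega`. -/
abbrev FunField (f : ℂ[X]) : Type :=
  QuadraticAlgebra (RatFunc ℂ) (algebraMap ℂ[X] (RatFunc ℂ) f) 0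

namespace Point

variable {f : ℂ[X]} {g : ℕ}

/-- The double cover given by the `x`-coordinate; `OnePoint ℂ` is the projective line. -/
def xMap : Point f g → OnePoint ℂ
  | affine a _ _ => (a : OnePoint ℂ)
  | infty _ _ => OnePoint.infty

/-- The involution `y ↦ -y` belonging to the double cover `xMap`. -/
def invol : Point f g → Point f g
  | affine a b h => affine a (-b) (by rw [neg_sq, h])
  | infty b h => infty (-b) (by rw [neg_sq, h])

/-- The ramification points of the double cover `xMap`, i.e. the fixed points of `invol`. -/
def ramification (f : ℂ[X]) (g : ℕ) : Set (Point f g) := {P | P.invol = P}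

/-- Coordinate functions of the affine chart used at `P`: `(x, y)` at an affine point,
`(1/x, y/x^(g+1))` at a point at infinity. -/
def chartFun : Point f g → Fin 2 → FunField f
  | affine _ _ _ => ![algebraMap (RatFunc ℂ) _ RatFunc.X, QuadraticAlgebra.omega]
  | infty _ _ => ![algebraMap (RatFunc ℂ) _ (RatFunc.X)⁻¹,
      algebraMap (RatFunc ℂ) _ ((RatFunc.X)⁻¹ ^ (g + 1)) * QuadraticAlgebra.omega]

/-- The coordinates of `P` in its chart. -/
def chartVal : Point f g → Fin 2 → ℂ
  | affine a b _ => ![a, b]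
  | infty b _ => ![0, b]

/-- A uniformizer at `P`: if the chart coordinates are `(s, t)`, the curve is locally `t² = h(s)`
with `h` squarefree, so `s - s(P)` is a uniformizer if `t(P) ≠ 0`, and `t` is one if `t(P) = 0`. -/
def unif (P : Point f g) : FunField f :=
  open Classical in
  if P.chartVal 1 = 0 then P.chartFun 1
  else P.chartFun 0 - algebraMap ℂ (FunField f) (P.chartVal 0)

/-- `φ` has order `k` at `P`: `φ = τ^k · p/q` with `τ` the uniformizer and `p`, `q` polynomials in
the chart coordinates that do not vanish at `P`. The exponent is split as `k = m - n`. -/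
def HasOrder (P : Point f g) (φ : FunField f) (k : ℤ) : Prop :=
  ∃ (m n : ℕ) (p q : MvPolynomial (Fin 2) ℂ), k = (m : ℤ) - n ∧
    MvPolynomial.eval P.chartVal p ≠ 0 ∧ MvPolynomial.eval P.chartVal q ≠ 0 ∧
    φ * MvPolynomial.aeval P.chartFun q * P.unif ^ n =
      MvPolynomial.aeval P.chartFun p * P.unif ^ m

end Point

/-- The divisors of the nonzero rational functions on `y² = f(x)`. -/
def principal (f : ℂ[X]) (g : ℕ) : AddSubgroup (Point f g →₀ ℤ) where
  carrier := {D | ∃ φ : FunField f, IsUnit φ ∧ ∀ P : Point f g, P.HasOrder φ (D P)}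
  zero_mem' := ⟨1, isUnit_one, fun _ => ⟨0, 0, 1, 1, by simp, by simp, by simp, by simp⟩⟩
  add_mem' := by
    rintro D D' ⟨φ, hφ, h⟩ ⟨φ', hφ', h'⟩
    refine ⟨φ * φ', hφ.mul hφ', fun P => ?_⟩
    obtain ⟨m, n, p, q, hk, hp, hq, e⟩ := h P
    obtain ⟨m', n', p', q', hk', hp', hq', e'⟩ := h' P
    refine ⟨m + m', n + n', p * p', q * q', ?_, ?_, ?_, ?_⟩
    · rw [Finsupp.add_apply, hk, hk']; push_cast; ring
    · rw [map_mul]; exact mul_ne_zero hp hp'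
    · rw [map_mul]; exact mul_ne_zero hq hq'
    · rw [map_mul, map_mul, pow_add, pow_add]
      linear_combination (φ' * MvPolynomial.aeval P.chartFun q' * P.unif ^ n') * e +
        (MvPolynomial.aeval P.chartFun p * P.unif ^ m) * e'
  neg_mem' := by
    rintro D ⟨φ, hφ, h⟩
    obtain ⟨ψ, hψ⟩ := hφ.exists_right_inv
    refine ⟨ψ, IsUnit.of_mul_eq_one φ (by rw [mul_comm, hψ]), fun P => ?_⟩
    obtain ⟨m, n, p, q, hk, hp, hq, e⟩ := h P
    refine ⟨n, m, q, p, ?_, hq, hp, ?_⟩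
    · rw [Finsupp.neg_apply, hk]; ring
    · linear_combination (-ψ) * e + (MvPolynomial.aeval P.chartFun q * P.unif ^ n) * hψ

/-- The group of divisors of degree zero. -/
abbrev DivZero (f : ℂ[X]) (g : ℕ) : AddSubgroup (Point f g →₀ ℤ) :=
  (Finsupp.degree : (Point f g →₀ ℤ) →+ ℤ).ker

/-- The group of complex points of the Jacobian: divisors of degree zero up to linear
equivalence. -/
abbrev Jac (f : ℂ[X]) (g : ℕ) : Type :=
  DivZero f g ⧸ (principal f g).addSubgroupOf (DivZero f g)

/-- The class `[P - Q]` in the Jacobian. -/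
def diff {f : ℂ[X]} {g : ℕ} (P Q : Point f g) : Jac f g :=
  QuotientAddGroup.mk (s := (principal f g).addSubgroupOf (DivZero f g))
    ⟨Finsupp.single P 1 - Finsupp.single Q 1, by simp [AddMonoidHom.mem_ker]⟩

/-- A torsion packet: a maximal set of points whose pairwise differences have finite order in the
Jacobian. -/
def IsTorsionPacket {f : ℂ[X]} {g : ℕ} (T : Set (Point f g)) : Prop :=
  Maximal (fun S : Set (Point f g) => ∀ P ∈ S, ∀ Q ∈ S, IsOfFinAddOrder (diff P Q)) T

/-- The hyperelliptic torsion packet: the torsion packet that contains the ramification points of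
the hyperelliptic double cover. -/
def IsHyperellipticTorsionPacket {f : ℂ[X]} {g : ℕ} (T : Set (Point f g)) : Prop :=
  IsTorsionPacket T ∧ Point.ramification f g ⊆ T

/-- The torsion points of the elliptic curve `y² = f(x)`, `deg f ∈ {3, 4}`, with origin `O`.
The group law is the one for which `P ↦ [P - O]` is an isomorphism onto the Jacobian. -/
def torsionPoints {f : ℂ[X]} (O : Point f 1) : Set (Point f 1) :=
  {P | IsOfFinAddOrder (diff P O)}

/-- The common torsion `x`-coordinates `π₁(E₁,tors) ∩ π₂(E₂,tors)` of two elliptic curves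
`Eⱼ : y² = fⱼ(x)` with origins `Oⱼ`, where `πⱼ` is the `x`-coordinate. -/
def commonTorsion {f₁ f₂ : ℂ[X]} (O₁ : Point f₁ 1) (O₂ : Point f₂ 1) : Set (OnePoint ℂ) :=
  Point.xMap '' torsionPoints O₁ ∩ Point.xMap '' torsionPoints O₂

/-- The right-hand side of the genus two curve `C : y² = (x² - u)(x² - v)(x² - w)`. -/
def polyC (u v w : ℂ) : ℂ[X] := (X ^ 2 - C u) * (X ^ 2 - C v) * (X ^ 2 - C w)

/-- The right-hand side of the elliptic curve `E : y² = (x - u)(x - v)(x - w)`. -/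
def polyE (u v w : ℂ) : ℂ[X] := (X - C u) * (X - C v) * (X - C w)

/-- The right-hand side of the elliptic curve `E' : y² = x(x - u)(x - v)(x - w)`. -/
def polyE' (u v w : ℂ) : ℂ[X] := X * (X - C u) * (X - C v) * (X - C w)

theorem coeff_polyE (u v w : ℂ) : (polyE u v w).coeff (2 * 1 + 2) = 0 := by
  apply coeff_eq_zero_of_natDegree_lt
  have : (polyE u v w).natDegree ≤ 3 := by unfold polyE; compute_degree
  omega

theorem coeff_polyC (u v w : ℂ) : (polyC u v w).coeff (2 * 2 + 2) = 1 := by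
  unfold polyC; compute_degree!

theorem coeff_polyE' (u v w : ℂ) : (polyE' u v w).coeff (2 * 1 + 2) = 1 := by
  unfold polyE'; compute_degree!

/-- The quotient map `ψ : C → E`, `(x, y) ↦ (x², y)`, by the involution `(x, y) ↦ (-x, y)`. -/
def psi {u v w : ℂ} : Point (polyC u v w) 2 → Point (polyE u v w) 1
  | .affine a b h => .affine (a ^ 2) b (by simpa [polyC, polyE] using h)
  | .infty _ _ => .infty 0 (by rw [coeff_polyE]; norm_num)

/-- The quotient map `ψ' : C → E'`, `(x, y) ↦ (x², xy)`, by the involution `(x, y) ↦ (-x, -y)`.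
At infinity, `xy/(x²)² = y/x³`. -/
def psi' {u v w : ℂ} : Point (polyC u v w) 2 → Point (polyE' u v w) 1
  | .affine a b h => .affine (a ^ 2) (a * b) (by
      rw [mul_pow, h]; simp [polyC, polyE']; ring)
  | .infty b h => .infty b (by rw [h, coeff_polyC, coeff_polyE'])

/-- The natural map `ρ : C → E ×_{ℙ¹} E' → ℙ¹`, which is `(x, y) ↦ x²`. -/
def rho {u v w : ℂ} (P : Point (polyC u v w) 2) : OnePoint ℂ := (psi P).xMap

theorem rho_eq_xMap_psi' {u v w : ℂ} (P : Point (polyC u v w) 2) : rho P = (psi' P).xMap := by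
  cases P <;> simp only [rho, psi, psi', Point.xMap]

end DoubleCover

end

/-! Write `ι` for the hyperelliptic involution `(x, y) ↦ (x, -y)` of `C` and `σ` for `(x, y) ↦ (-x,
y)`, so that `psi` and `psi'` are the quotients by `σ` and `σι`. In the group ring of `{1, ι, σ,
σι}`, `2 = (1 + σ) + (1 + σι) - σ(1 + ι)`. Apply this to `P - W`. The last term gives a principal
divisor, since all fibers of `x` are linearly equivalent; the first two give the pullbacks of `psi P
- psi W` and `psi' P - psi' W`. So if both images are torsion, then `2(P - W)`, hence `P - W`, is
torsion. Conversely, if `n(P - W)` is the divisor of `φ`, the norm of `φ` along each quotient map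
has divisor `n` times the difference of the images. This is the isogeny between the Jacobian of `C`
and `E × E'`, stated for differences of points (`isOfFinAddOrder_diff_polyC_iff`).

Ramification points differ by 2-torsion, so the packet is the class of any one of them, and the
origins `O`, `O'` may be replaced by the images of a ramification point of `C`. Torsion on an
elliptic curve with such an origin is stable under `-1`, so it depends only on the `x`-coordinate,
and the packet is a full preimage under `rho`.

For the size, `rho` has degree 4, with fibers of two points over `u`, `v`, `w`, `0`, `∞` and of four
points elsewhere. The points `u`, `v`, `w` always lie in the common torsion.

Two facts about `HasOrder` support this: every unit of the function field has an order at every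
point (`exists_hasOrder`), and the order is unique (`HasOrder.unique`). -/

noncomputable section

namespace DoubleCover

/-! ### Smooth models and their charts -/

open QuadraticAlgebra

/-- The conditions on `f` under which `Point f g` is the smooth projective model of `y² = f(x)`. -/
structure IsSmoothModel (f : ℂ[X]) (g : ℕ) : Prop where
  natDegree_le : f.natDegree ≤ 2 * g + 2
  eval_derivative_ne_zero : ∀ a, f.eval a = 0 → f.derivative.eval a ≠ 0
  coeff_ne_zero : f.coeff (2 * g + 2) = 0 → f.coeff (2 * g + 1) ≠ 0

theorem IsSmoothModel.ne_zero {f : ℂ[X]} {g : ℕ} (hf : IsSmoothModel f g) : f ≠ 0 := by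
  rintro rfl
  exact hf.eval_derivative_ne_zero 0 (by simp) (by simp)

theorem aeval_reflect_inv (p : ℂ[X]) {N : ℕ} (hN : p.natDegree ≤ N) :
    aeval (RatFunc.X : RatFunc ℂ)⁻¹ (p.reflect N) * RatFunc.X ^ N =
      algebraMap ℂ[X] (RatFunc ℂ) p := by
  have hX : (RatFunc.X : RatFunc ℂ) ≠ 0 := RatFunc.X_ne_zero
  let i : Invertible (RatFunc.X : RatFunc ℂ) := invertibleOfNonzero hX
  have h := eval₂_reflect_mul_pow (algebraMap ℂ (RatFunc ℂ)) (RatFunc.X : RatFunc ℂ) N p hN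
  rw [invOf_eq_inv, ← aeval_def, ← aeval_def] at h
  rw [h, ← RatFunc.algebraMap_X, aeval_algebraMap_apply, aeval_X_left_apply]

theorem aeval_ratFunc_X (p : ℂ[X]) :
    aeval (RatFunc.X : RatFunc ℂ) p = algebraMap ℂ[X] (RatFunc ℂ) p := by
  rw [← RatFunc.algebraMap_X, aeval_algebraMap_apply, aeval_X_left_apply]

namespace Point

variable {f : ℂ[X]} {g : ℕ}

/-- The first chart coordinate as an element of `ℂ(x)`. -/
def base : Point f g → RatFunc ℂ
  | affine _ _ _ => RatFunc.X
  | infty _ _ => RatFunc.X⁻¹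

/-- The ratio of the second chart coordinate to `y`. -/
def scale : Point f g → RatFunc ℂ
  | affine _ _ _ => 1
  | infty _ _ => RatFunc.X⁻¹ ^ (g + 1)

/-- The polynomial `h` such that `t² = h(s)` for the chart coordinates `(s, t)` used at `P`. -/
def chartPoly : Point f g → ℂ[X]
  | affine _ _ _ => f
  | infty _ _ => f.reflect (2 * g + 2)

theorem chartFun_zero (P : Point f g) :
    P.chartFun 0 = algebraMap (RatFunc ℂ) (FunField f) P.base := by
  cases P <;> rfl

theorem chartFun_one (P : Point f g) :
    P.chartFun 1 = algebraMap (RatFunc ℂ) (FunField f) P.scale * omega := by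
  cases P <;> simp [chartFun, scale]

theorem scale_ne_zero (P : Point f g) : P.scale ≠ 0 := by
  cases P
  · exact one_ne_zero
  · exact pow_ne_zero _ (inv_ne_zero RatFunc.X_ne_zero)

theorem transcendental_base (P : Point f g) : Transcendental ℂ P.base := by
  cases P
  · exact RatFunc.transcendental_X
  · exact fun h => RatFunc.transcendental_X (IsAlgebraic.inv_iff.1 h)

theorem aeval_base_eq_zero (P : Point f g) {A : ℂ[X]} : aeval P.base A = 0 ↔ A = 0 :=
  ⟨fun h => transcendental_iff.1 P.transcendental_base A h, fun h => by rw [h, map_zero]⟩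

/-- The base coordinate is `x` or `1/x`, and either one generates `ℂ(x)`. -/
theorem exists_ratFunc_mul_aeval_base (P : Point f g) (α : RatFunc ℂ) :
    ∃ A D : ℂ[X], D ≠ 0 ∧ α * aeval P.base D = aeval P.base A := by
  have hα : α * algebraMap ℂ[X] (RatFunc ℂ) α.denom = algebraMap ℂ[X] (RatFunc ℂ) α.num :=
    ((div_eq_iff (RatFunc.algebraMap_ne_zero α.denom_ne_zero)).1 α.num_div_denom).symm
  cases P with
  | affine a b h =>
    exact ⟨α.num, α.denom, α.denom_ne_zero, by simpa only [base, aeval_ratFunc_X] using hα⟩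
  | infty b h =>
    -- Reversing both polynomials in the same degree makes the powers of `x` cancel.
    set N := max α.num.natDegree α.denom.natDegree
    refine ⟨α.num.reflect N, α.denom.reflect N, fun h => α.denom_ne_zero ?_, ?_⟩
    · rwa [reflect_eq_zero_iff] at h
    · have hX : (RatFunc.X : RatFunc ℂ) ^ N ≠ 0 := pow_ne_zero _ RatFunc.X_ne_zero
      rw [← aeval_reflect_inv _ (le_max_left _ _ : _ ≤ N),
        ← aeval_reflect_inv _ (le_max_right _ _ : _ ≤ N), ← mul_assoc] at hα
      exact mul_right_cancel₀ hX hα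

theorem aeval_chartFun_zero (P : Point f g) (A : ℂ[X]) :
    aeval (P.chartFun 0) A = algebraMap (RatFunc ℂ) (FunField f) (aeval P.base A) := by
  rw [chartFun_zero, aeval_algebraMap_apply]

theorem aeval_chartFun_eq_zero (P : Point f g) {A B : ℂ[X]}
    (h : aeval (P.chartFun 0) A + aeval (P.chartFun 0) B * P.chartFun 1 = 0) :
    A = 0 ∧ B = 0 := by
  rw [aeval_chartFun_zero, aeval_chartFun_zero, chartFun_one] at h
  have hre := congrArg QuadraticAlgebra.re h
  have him := congrArg QuadraticAlgebra.im h
  simp only [re_add, im_add, re_mul, im_mul, algebraMap_re, algebraMap_im, omega_re, omega_im,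
    re_zero, im_zero, mul_zero, zero_mul, add_zero, zero_add, mul_one] at hre him
  exact ⟨P.aeval_base_eq_zero.1 hre,
    P.aeval_base_eq_zero.1 ((mul_eq_zero.1 him).resolve_right P.scale_ne_zero)⟩

theorem exists_mul_aeval_chartFun (P : Point f g) (φ : FunField f) :
    ∃ A B D : ℂ[X], D ≠ 0 ∧ φ * aeval (P.chartFun 0) D =
      aeval (P.chartFun 0) A + aeval (P.chartFun 0) B * P.chartFun 1 := by
  obtain ⟨A, D, hD, hA⟩ := P.exists_ratFunc_mul_aeval_base φ.re
  obtain ⟨B, D', hD', hB⟩ := P.exists_ratFunc_mul_aeval_base (φ.im / P.scale)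
  have hs := P.scale_ne_zero
  refine ⟨A * D', B * D, D * D', mul_ne_zero hD hD', ?_⟩
  simp only [aeval_chartFun_zero, chartFun_one]
  ext
  · simp only [re_add, re_mul, im_mul, algebraMap_re, algebraMap_im, omega_re, omega_im, map_mul]
    linear_combination aeval P.base D' * hA
  · simp only [im_add, re_mul, im_mul, algebraMap_re, algebraMap_im, omega_re, omega_im, map_mul]
    have : φ.im * aeval P.base D' = aeval P.base B * P.scale := by
      rw [← hB]; field_simp
    linear_combination aeval P.base D * this

theorem omega_sq : (omega : FunField f) ^ 2 =
    algebraMap (RatFunc ℂ) (FunField f) (algebraMap ℂ[X] (RatFunc ℂ) f) := by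
  rw [sq, omega_mul_omega_eq_mk]; rfl

theorem chartFun_one_sq (hf : f.natDegree ≤ 2 * g + 2) (P : Point f g) :
    P.chartFun 1 ^ 2 = aeval (P.chartFun 0) P.chartPoly := by
  rw [aeval_chartFun_zero, chartFun_one, mul_pow, omega_sq, ← map_pow, ← map_mul]
  congr 1
  cases P with
  | affine a b h => simp only [scale, base, chartPoly, one_pow, one_mul, aeval_ratFunc_X]
  | infty b h =>
    have hX : (RatFunc.X : RatFunc ℂ) ≠ 0 := RatFunc.X_ne_zero
    simp only [scale, base, chartPoly]
    rw [← aeval_reflect_inv f hf, ← pow_mul, show (g + 1) * 2 = 2 * g + 2 by ring, mul_left_comm,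
      ← mul_pow, inv_mul_cancel₀ hX, one_pow, mul_one]

theorem chartVal_one_sq (P : Point f g) :
    P.chartVal 1 ^ 2 = P.chartPoly.eval (P.chartVal 0) := by
  cases P with
  | affine a b h => exact h
  | infty b h =>
    simp only [chartVal, chartPoly, Matrix.cons_val_zero, Matrix.cons_val_one]
    rw [h, ← coeff_zero_eq_eval_zero, coeff_reflect, revAt_le (Nat.zero_le _), Nat.sub_zero]

/-- Smoothness at a branch point: the root of the chart polynomial is simple. At infinity its
derivative at `0` is the coefficient of `f` in degree `2g + 1`. -/
theorem exists_chartPoly_eq (hf : IsSmoothModel f g) (P : Point f g) (hP : P.chartVal 1 = 0) :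
    ∃ h : ℂ[X], P.chartPoly = (X - C (P.chartVal 0)) * h ∧ h.eval (P.chartVal 0) ≠ 0 := by
  have hroot : P.chartPoly.IsRoot (P.chartVal 0) := by
    rw [IsRoot, ← chartVal_one_sq, hP]; norm_num
  obtain ⟨h, hh⟩ := dvd_iff_isRoot.2 hroot
  refine ⟨h, hh, fun h0 => ?_⟩
  have hd : P.chartPoly.derivative.eval (P.chartVal 0) = 0 := by
    rw [hh]; simp [h0]
  cases P with
  | affine a b e => exact hf.eval_derivative_ne_zero a hroot hd
  | infty b e =>
    simp only [chartVal, chartPoly, Matrix.cons_val_zero, Matrix.cons_val_one] at hd hP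
    subst hP
    refine hf.coeff_ne_zero (by rw [← e]; norm_num) ?_
    rw [← coeff_zero_eq_eval_zero, coeff_derivative, coeff_reflect, revAt_le (by omega)] at hd
    simpa using hd

end Point

/-! ### Existence and uniqueness of the order of a function -/

namespace Point

variable {f : ℂ[X]} {g : ℕ}

theorem unif_of_eq_zero {P : Point f g} (h : P.chartVal 1 = 0) : P.unif = P.chartFun 1 := by
  rw [unif, if_pos h]

theorem unif_of_ne_zero {P : Point f g} (h : P.chartVal 1 ≠ 0) :
    P.unif = P.chartFun 0 - algebraMap ℂ (FunField f) (P.chartVal 0) := by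
  rw [unif, if_neg h]

theorem isUnit_algebraMap_ratFunc {α : RatFunc ℂ} (h : α ≠ 0) :
    IsUnit (algebraMap (RatFunc ℂ) (FunField f) α) :=
  (isUnit_iff_ne_zero.2 h).map _

theorem isUnit_aeval_chartFun_zero (P : Point f g) {A : ℂ[X]} (hA : A ≠ 0) :
    IsUnit (aeval (P.chartFun 0) A) := by
  rw [aeval_chartFun_zero]
  exact isUnit_algebraMap_ratFunc (mt P.aeval_base_eq_zero.1 hA)

theorem isUnit_omega (hf : f ≠ 0) : IsUnit (omega : FunField f) := by
  rw [← isUnit_pow_iff two_ne_zero, omega_sq]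
  exact isUnit_algebraMap_ratFunc (RatFunc.algebraMap_ne_zero hf)

theorem isUnit_unif (hf : f ≠ 0) (P : Point f g) : IsUnit P.unif := by
  by_cases h : P.chartVal 1 = 0
  · rw [unif_of_eq_zero h, chartFun_one]
    exact (isUnit_algebraMap_ratFunc P.scale_ne_zero).mul (isUnit_omega hf)
  · rw [unif_of_ne_zero h]
    simpa using P.isUnit_aeval_chartFun_zero (X_sub_C_ne_zero (P.chartVal 0))

namespace HasOrder

variable {P : Point f g} {φ ψ : FunField f} {k l : ℤ}

theorem mul (h : P.HasOrder φ k) (h' : P.HasOrder ψ l) : P.HasOrder (φ * ψ) (k + l) := by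
  obtain ⟨m, n, p, q, hk, hp, hq, e⟩ := h
  obtain ⟨m', n', p', q', hk', hp', hq', e'⟩ := h'
  refine ⟨m + m', n + n', p * p', q * q', ?_, ?_, ?_, ?_⟩
  · rw [hk, hk']; push_cast; ring
  · rw [map_mul]; exact mul_ne_zero hp hp'
  · rw [map_mul]; exact mul_ne_zero hq hq'
  · rw [map_mul, map_mul, pow_add, pow_add]
    linear_combination (ψ * MvPolynomial.aeval P.chartFun q' * P.unif ^ n') * e +
      (MvPolynomial.aeval P.chartFun p * P.unif ^ m) * e'

/-- Division, phrased through a product because `FunField f` is handled as a ring. -/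
theorem of_mul (h : P.HasOrder ψ l) (h' : P.HasOrder (φ * ψ) k) : P.HasOrder φ (k - l) := by
  obtain ⟨m, n, p, q, hk, hp, hq, e⟩ := h
  obtain ⟨m', n', p', q', hk', hp', hq', e'⟩ := h'
  refine ⟨m' + n, n' + m, p' * q, q' * p, ?_, ?_, ?_, ?_⟩
  · rw [hk, hk']; push_cast; ring
  · rw [map_mul]; exact mul_ne_zero hp' hq
  · rw [map_mul]; exact mul_ne_zero hq' hp
  · rw [map_mul, map_mul, pow_add, pow_add]
    linear_combination (MvPolynomial.aeval P.chartFun q * P.unif ^ n) * e' -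
      (φ * MvPolynomial.aeval P.chartFun q' * P.unif ^ n') * e

theorem aeval {p : MvPolynomial (Fin 2) ℂ} (hp : MvPolynomial.eval P.chartVal p ≠ 0) :
    P.HasOrder (MvPolynomial.aeval P.chartFun p) 0 :=
  ⟨0, 0, p, 1, by simp, hp, by simp, by simp⟩

theorem unif : P.HasOrder P.unif 1 :=
  ⟨1, 0, 1, 1, by simp, by simp, by simp, by simp⟩

theorem one : P.HasOrder 1 0 :=
  ⟨0, 0, 1, 1, by simp, by simp, by simp, by simp⟩

theorem pow (h : P.HasOrder φ k) (n : ℕ) : P.HasOrder (φ ^ n) (n * k) := by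
  induction n with
  | zero => simpa using one
  | succ n ih => rw [pow_succ]; convert ih.mul h using 1; push_cast; ring

theorem polynomial {A B : ℂ[X]}
    (h : A.eval (P.chartVal 0) + B.eval (P.chartVal 0) * P.chartVal 1 ≠ 0) :
    P.HasOrder (Polynomial.aeval (P.chartFun 0) A +
      Polynomial.aeval (P.chartFun 0) B * P.chartFun 1) 0 := by
  have hev (D : ℂ[X]) : MvPolynomial.eval P.chartVal (Polynomial.aeval (MvPolynomial.X 0) D) =
      D.eval (P.chartVal 0) := by
    have := Polynomial.aeval_algHom_apply (MvPolynomial.aeval P.chartVal) (MvPolynomial.X 0) D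
    rw [MvPolynomial.aeval_X, Polynomial.coe_aeval_eq_eval] at this
    exact this.symm
  have := aeval (P := P) (p := Polynomial.aeval (MvPolynomial.X 0) A +
    Polynomial.aeval (MvPolynomial.X 0) B * MvPolynomial.X 1) (by simpa [hev] using h)
  simpa [← Polynomial.aeval_algHom_apply] using this

theorem polynomial_zero {A : ℂ[X]} (h : A.eval (P.chartVal 0) ≠ 0) :
    P.HasOrder (Polynomial.aeval (P.chartFun 0) A) 0 := by
  simpa using polynomial (P := P) (A := A) (B := 0) (by simpa using h)

end HasOrder

/-- The ramification index of `xMap` at `P`. -/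
def xRamification (P : Point f g) : ℤ :=
  open Classical in if P.chartVal 1 = 0 then 2 else 1

/-- At a branch point `t² = (s - s(P)) h(s)` with `h(s(P)) ≠ 0` and `t` a uniformizer; elsewhere `s
- s(P)` is itself the uniformizer. -/
theorem hasOrder_chartFun_zero_sub (hf : IsSmoothModel f g) (P : Point f g) :
    P.HasOrder (P.chartFun 0 - algebraMap ℂ (FunField f) (P.chartVal 0)) P.xRamification := by
  by_cases hP : P.chartVal 1 = 0
  · obtain ⟨h, hh, h0⟩ := P.exists_chartPoly_eq hf hP
    have e := P.chartFun_one_sq hf.natDegree_le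
    rw [hh, map_mul] at e
    have hu := (HasOrder.unif (P := P)).pow 2
    rw [unif_of_eq_zero hP, e] at hu
    simpa [xRamification, hP] using (HasOrder.polynomial_zero h0).of_mul hu
  · rw [← unif_of_ne_zero hP, xRamification, if_neg hP]
    exact HasOrder.unif

theorem exists_hasOrder_aeval (hf : IsSmoothModel f g) (P : Point f g) {A : ℂ[X]} (hA : A ≠ 0) :
    ∃ k, P.HasOrder (aeval (P.chartFun 0) A) k := by
  obtain ⟨B, hB, hdvd⟩ := A.exists_eq_pow_rootMultiplicity_mul_and_not_dvd hA (P.chartVal 0)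
  rw [dvd_iff_isRoot] at hdvd
  have := ((P.hasOrder_chartFun_zero_sub hf).pow (A.rootMultiplicity (P.chartVal 0))).mul
    (HasOrder.polynomial_zero hdvd)
  have e := congrArg (aeval (P.chartFun 0)) hB
  rw [map_mul, map_pow, map_sub, aeval_X, aeval_C] at e
  exact ⟨_, e ▸ this⟩

/-- Coprimality prevents `A` and `B` from both vanishing at `P`. If `A + Bt` vanishes at `P`, then
at a branch point it has a simple zero, and elsewhere its conjugate `A - Bt` does not vanish, so its
order is that of the norm, a polynomial in `s`. -/
theorem exists_hasOrder_of_isCoprime (hf : IsSmoothModel f g) (P : Point f g) {A B : ℂ[X]}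
    (hAB : IsCoprime A B) (hN : A ^ 2 - B ^ 2 * P.chartPoly ≠ 0) :
    ∃ k, P.HasOrder (aeval (P.chartFun 0) A + aeval (P.chartFun 0) B * P.chartFun 1) k := by
  have hne : ¬ (A.eval (P.chartVal 0) = 0 ∧ B.eval (P.chartVal 0) = 0) := by
    rintro ⟨hA, hB⟩
    obtain ⟨r, s, hrs⟩ := hAB
    simpa [hA, hB] using congrArg (eval (P.chartVal 0)) hrs
  by_cases h0 : A.eval (P.chartVal 0) + B.eval (P.chartVal 0) * P.chartVal 1 ≠ 0
  · exact ⟨0, HasOrder.polynomial h0⟩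
  rw [not_not] at h0
  have hsq := P.chartFun_one_sq hf.natDegree_le
  by_cases hP : P.chartVal 1 = 0
  · rw [hP, mul_zero, add_zero] at h0
    obtain ⟨h, hh, hh0⟩ := P.exists_chartPoly_eq hf hP
    obtain ⟨A₁, hA₁⟩ := dvd_iff_isRoot.2 h0
    have hu := HasOrder.unif (P := P)
    rw [unif_of_eq_zero hP] at hu
    -- With `A = (s - s(P)) A₁` and `t² = (s - s(P)) h`, one has `h (A + B t) = t (B h + A₁ t)`, and
    -- the last factor is nonzero at `P`.
    have hB : P.HasOrder (aeval (P.chartFun 0) (B * h) +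
        aeval (P.chartFun 0) A₁ * P.chartFun 1) 0 := by
      refine HasOrder.polynomial ?_
      rw [hP, mul_zero, add_zero, eval_mul]
      exact mul_ne_zero (fun hB => hne ⟨h0, hB⟩) hh0
    refine ⟨_, (HasOrder.polynomial_zero hh0).of_mul (k := 1 + 0) ?_⟩
    convert hu.mul hB using 1
    rw [hh, map_mul] at hsq
    rw [hA₁, map_mul, map_mul]
    linear_combination (-aeval (P.chartFun 0) A₁) * hsq
  · have h1 : P.HasOrder (aeval (P.chartFun 0) A + aeval (P.chartFun 0) (-B) * P.chartFun 1) 0 := by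
      refine HasOrder.polynomial fun h1 => hne ?_
      rw [eval_neg] at h1
      have hA : A.eval (P.chartVal 0) = 0 := by linear_combination (h0 + h1) / 2
      refine ⟨hA, ?_⟩
      rw [hA, zero_add] at h0
      exact (mul_eq_zero.1 h0).resolve_right hP
    obtain ⟨k, hk⟩ := P.exists_hasOrder_aeval hf hN
    refine ⟨_, h1.of_mul (k := k) ?_⟩
    convert hk using 1
    simp only [map_sub, map_mul, map_pow, map_neg]
    linear_combination (-aeval (P.chartFun 0) B ^ 2) * hsq

/-- Clear the denominator and take out the gcd; this leaves polynomials in `s` and a coprime pair.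
-/
theorem exists_hasOrder (hf : IsSmoothModel f g) (P : Point f g) {φ : FunField f}
    (hφ : IsUnit φ) : ∃ k, P.HasOrder φ k := by
  obtain ⟨A, B, D, hD, e⟩ := P.exists_mul_aeval_chartFun φ
  have hu := hφ.mul (P.isUnit_aeval_chartFun_zero hD)
  have hAB : ¬ (A = 0 ∧ B = 0) := by
    rintro ⟨rfl, rfl⟩
    rw [e] at hu
    simp at hu
  have hd : EuclideanDomain.gcd A B ≠ 0 := fun h => hAB (EuclideanDomain.gcd_eq_zero_iff.1 h)
  obtain ⟨A', hA⟩ := EuclideanDomain.gcd_dvd_left A B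
  obtain ⟨B', hB⟩ := EuclideanDomain.gcd_dvd_right A B
  set d := EuclideanDomain.gcd A B with hdef
  have hco : IsCoprime A' B' := by
    refine ⟨EuclideanDomain.gcdA A B, EuclideanDomain.gcdB A B, mul_left_cancel₀ hd ?_⟩
    have := EuclideanDomain.gcd_eq_gcd_ab A B
    rw [← hdef] at this
    linear_combination -this - EuclideanDomain.gcdA A B * hA - EuclideanDomain.gcdB A B * hB
  have hfac : φ * aeval (P.chartFun 0) D = aeval (P.chartFun 0) d *
      (aeval (P.chartFun 0) A' + aeval (P.chartFun 0) B' * P.chartFun 1) := by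
    rw [e]
    conv_lhs => rw [hA, hB]
    rw [map_mul, map_mul]
    ring
  -- If the norm vanished, the unit `A' + B't` would kill its conjugate, forcing `A' = B' = 0`
  -- against coprimality.
  have hN : A' ^ 2 - B' ^ 2 * P.chartPoly ≠ 0 := by
    intro hN
    have hsq := P.chartFun_one_sq hf.natDegree_le
    have hN' := congrArg (aeval (P.chartFun 0)) hN
    simp only [map_sub, map_mul, map_pow, map_zero] at hN'
    rw [hfac] at hu
    have hz : aeval (P.chartFun 0) A' + aeval (P.chartFun 0) (-B') * P.chartFun 1 = 0 := by
      refine (isUnit_of_mul_isUnit_right hu).mul_right_eq_zero.1 ?_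
      rw [map_neg]
      linear_combination hN' - aeval (P.chartFun 0) B' ^ 2 * hsq
    obtain ⟨h1, h2⟩ := P.aeval_chartFun_eq_zero hz
    rw [neg_eq_zero] at h2
    rw [h1, h2] at hco
    exact not_isCoprime_zero_zero hco
  obtain ⟨k, hk⟩ := P.exists_hasOrder_aeval hf hD
  obtain ⟨l, hl⟩ := P.exists_hasOrder_aeval hf hd
  obtain ⟨m, hm⟩ := P.exists_hasOrder_of_isCoprime hf hco hN
  exact ⟨_, hk.of_mul (hfac ▸ hl.mul hm)⟩

/-- Evaluation at `P` is well defined on functions polynomial in the chart coordinates: modulo `t² =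
h(s)`, which also holds at `P`, every polynomial reduces to `A(s) + B(s) t`, and `1, t` are
independent over `ℂ[s]`. -/
theorem eval_chartVal_eq_zero (hf : f.natDegree ≤ 2 * g + 2) (P : Point f g)
    {p : MvPolynomial (Fin 2) ℂ} (h : MvPolynomial.aeval P.chartFun p = 0) :
    MvPolynomial.eval P.chartVal p = 0 := by
  have key : ∃ A B : ℂ[X], MvPolynomial.aeval P.chartFun p =
      aeval (P.chartFun 0) A + aeval (P.chartFun 0) B * P.chartFun 1 ∧
      MvPolynomial.eval P.chartVal p =
        A.eval (P.chartVal 0) + B.eval (P.chartVal 0) * P.chartVal 1 := by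
    clear h
    induction p using MvPolynomial.induction_on with
    | C a => exact ⟨C a, 0, by simp⟩
    | add p q hp hq =>
      obtain ⟨A, B, h1, h2⟩ := hp
      obtain ⟨A', B', h1', h2'⟩ := hq
      refine ⟨A + A', B + B', ?_, ?_⟩
      · simp only [map_add, h1, h1']; ring
      · simp only [map_add, eval_add, h2, h2']; ring
    | mul_X p i hp =>
      obtain ⟨A, B, h1, h2⟩ := hp
      fin_cases i
      · refine ⟨A * X, B * X, ?_, ?_⟩
        · simp [h1]; ring
        · simp [h2]; ring
      · refine ⟨B * P.chartPoly, A, ?_, ?_⟩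
        · simp only [map_mul, h1, ← P.chartFun_one_sq hf, MvPolynomial.aeval_X, Fin.mk_one]; ring
        · simp only [map_mul, h2, eval_mul, ← P.chartVal_one_sq, MvPolynomial.eval_X,
            Fin.mk_one]; ring
  obtain ⟨A, B, h1, h2⟩ := key
  obtain ⟨rfl, rfl⟩ := P.aeval_chartFun_eq_zero (h1.symm.trans h)
  simpa using h2

theorem HasOrder.le (hf : f ≠ 0) (hd : f.natDegree ≤ 2 * g + 2) {P : Point f g} {φ : FunField f}
    {k l : ℤ} (h : P.HasOrder φ k) (h' : P.HasOrder φ l) : k ≤ l := by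
  obtain ⟨m, n, p, q, hk, hp, hq, e⟩ := h
  obtain ⟨m', n', p', q', hk', hp', hq', e'⟩ := h'
  by_contra hlt
  -- Here `j + 1 = k - l`. Cancelling powers of the uniformizer `τ` gives `p q' τ^(j+1) = p' q`,
  -- whose left side vanishes at `P` and whose right side does not.
  obtain ⟨j, hj⟩ : ∃ j : ℕ, m + n' = m' + n + (j + 1) := ⟨m + n' - (m' + n) - 1, by omega⟩
  obtain ⟨r, hr, hr0⟩ : ∃ r : MvPolynomial (Fin 2) ℂ, MvPolynomial.aeval P.chartFun r = P.unif ∧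
      MvPolynomial.eval P.chartVal r = 0 := by
    by_cases h : P.chartVal 1 = 0
    · exact ⟨MvPolynomial.X 1, by simp [unif_of_eq_zero h], by simpa using h⟩
    · exact ⟨MvPolynomial.X 0 - MvPolynomial.C (P.chartVal 0), by simp [unif_of_ne_zero h], by simp⟩
  have key : MvPolynomial.aeval P.chartFun (p * q' * r ^ (j + 1) - p' * q) = 0 := by
    refine ((P.isUnit_unif hf).pow (m' + n)).mul_right_eq_zero.1 ?_
    have hp : P.unif ^ m * P.unif ^ n' = P.unif ^ m' * P.unif ^ n * P.unif ^ (j + 1) := by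
      rw [← pow_add, hj, pow_add, pow_add]
    simp only [map_sub, map_mul, map_pow, hr, pow_add _ m' n]
    linear_combination (-(MvPolynomial.aeval P.chartFun p * MvPolynomial.aeval P.chartFun q')) * hp
      - (MvPolynomial.aeval P.chartFun q' * P.unif ^ n') * e
      + (MvPolynomial.aeval P.chartFun q * P.unif ^ n) * e'
  have := P.eval_chartVal_eq_zero hd key
  simp only [map_sub, map_mul, map_pow, hr0, pow_succ, mul_zero, zero_sub, neg_eq_zero] at this
  exact mul_ne_zero hp' hq this

theorem HasOrder.unique (hf : IsSmoothModel f g) {P : Point f g} {φ : FunField f}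
    {k l : ℤ} (h : P.HasOrder φ k) (h' : P.HasOrder φ l) : k = l :=
  le_antisymm (h.le hf.ne_zero hf.natDegree_le h') (h'.le hf.ne_zero hf.natDegree_le h)

end Point

/-! ### Pullback of functions along `(x, y) ↦ (r(x), c(x) y)` -/

section Pullback

theorem nonZeroDivisors_le_comap_aeval {r : ℂ[X]} (hr : 0 < r.natDegree) :
    nonZeroDivisors ℂ[X] ≤ (nonZeroDivisors ℂ[X]).comap (aeval r : ℂ[X] →ₐ[ℂ] ℂ[X]) := by
  intro p hp
  rw [mem_nonZeroDivisors_iff_ne_zero] at hp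
  rw [Submonoid.mem_comap, mem_nonZeroDivisors_iff_ne_zero]
  change p.comp r ≠ 0
  rw [Ne, comp_eq_zero_iff]
  rintro (h | ⟨-, h⟩)
  · exact hp h
  · rw [h, natDegree_C] at hr
    exact hr.false

/-- The substitution `x ↦ r(x)` on `ℂ(x)`, for a nonconstant polynomial `r`. -/
def ratFuncComp (r : ℂ[X]) (hr : 0 < r.natDegree) : RatFunc ℂ →ₐ[ℂ] RatFunc ℂ :=
  RatFunc.mapAlgHom (aeval r) (nonZeroDivisors_le_comap_aeval hr)

theorem ratFuncComp_algebraMap (r : ℂ[X]) (hr : 0 < r.natDegree) (p : ℂ[X]) :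
    ratFuncComp r hr (algebraMap ℂ[X] (RatFunc ℂ) p) = algebraMap ℂ[X] (RatFunc ℂ) (p.comp r) := by
  have := RatFunc.map_apply_div (aeval r) (nonZeroDivisors_le_comap_aeval hr) p 1
  rw [map_one, map_one, map_one, div_one, div_one] at this
  exact this

variable {f₁ f₂ : ℂ[X]}

/-- The homomorphism of function fields given by `x ↦ r(x)`, `y ↦ c(x) y`. -/
def pullback (r c : ℂ[X]) (hr : 0 < r.natDegree) (h : c ^ 2 * f₂ = f₁.comp r) :
    FunField f₁ →ₐ[ℂ] FunField f₂ where
  toFun z := ⟨ratFuncComp r hr z.re, algebraMap ℂ[X] (RatFunc ℂ) c * ratFuncComp r hr z.im⟩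
  map_one' := by ext <;> simp
  map_zero' := by ext <;> simp
  map_add' z w := by ext <;> simp [mul_add]
  map_mul' z w := by
    have := congrArg (algebraMap ℂ[X] (RatFunc ℂ)) h
    rw [map_mul, map_pow, ← ratFuncComp_algebraMap r hr] at this
    ext
    · simp only [re_mul, map_add, map_mul]
      linear_combination (-(ratFuncComp r hr z.im * ratFuncComp r hr w.im)) * this
    · simp only [im_mul, map_add, map_mul, map_zero]
      ring
  commutes' a := by
    ext
    · exact (ratFuncComp r hr).commutes a
    · exact (congrArg _ (map_zero _)).trans (mul_zero _)

theorem pullback_algebraMap (r c : ℂ[X]) (hr : 0 < r.natDegree) (h : c ^ 2 * f₂ = f₁.comp r)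
    (α : RatFunc ℂ) : pullback r c hr h (algebraMap (RatFunc ℂ) (FunField f₁) α) =
      algebraMap (RatFunc ℂ) (FunField f₂) (ratFuncComp r hr α) := by
  ext <;> simp [pullback]

theorem pullback_omega (r c : ℂ[X]) (hr : 0 < r.natDegree) (h : c ^ 2 * f₂ = f₁.comp r) :
    pullback r c hr h (omega : FunField f₁) =
      algebraMap (RatFunc ℂ) (FunField f₂) (algebraMap ℂ[X] (RatFunc ℂ) c) * omega := by
  ext <;> simp [pullback]

/-- An element is a unit exactly when its norm to `ℂ(x)` is nonzero, and the norm commutes with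
pullback. -/
theorem isUnit_of_isUnit_pullback (r c : ℂ[X]) (hr : 0 < r.natDegree)
    (h : c ^ 2 * f₂ = f₁.comp r) {φ : FunField f₁} (hφ : IsUnit (pullback r c hr h φ)) :
    IsUnit φ := by
  have hc := congrArg (algebraMap ℂ[X] (RatFunc ℂ)) h
  rw [map_mul, map_pow, ← ratFuncComp_algebraMap r hr] at hc
  have hnorm : norm (pullback r c hr h φ) = ratFuncComp r hr (norm φ) := by
    simp only [norm_def, pullback, AlgHom.coe_mk, RingHom.coe_mk, MonoidHom.coe_mk, OneHom.coe_mk,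
      map_sub, map_add, map_mul, map_zero]
    linear_combination (-ratFuncComp r hr φ.im ^ 2) * hc
  rw [isUnit_iff_norm_isUnit, isUnit_iff_ne_zero] at hφ ⊢
  intro h0
  rw [hnorm, h0, map_zero] at hφ
  exact hφ rfl

end Pullback

/-! ### Orders under pullback -/

namespace Point

variable {f₁ f₂ : ℂ[X]} {g₁ g₂ : ℕ}

/-- The map is given near `P` by the polynomials `ρ` in the chart coordinates and sends `P` to `Q`.
Functions that do not vanish at `Q` therefore pull back to functions that do not vanish at `P`, and
only the order `e` of the pulled back uniformizer matters. -/
theorem HasOrder.map {P : Point f₂ g₂} {Q : Point f₁ g₁} {e k : ℤ} {φ : FunField f₁}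
    (h : Q.HasOrder φ k) (Φ : FunField f₁ →ₐ[ℂ] FunField f₂) (ρ : Fin 2 → MvPolynomial (Fin 2) ℂ)
    (hρ : ∀ i, Φ (Q.chartFun i) = MvPolynomial.aeval P.chartFun (ρ i))
    (hv : ∀ i, MvPolynomial.eval P.chartVal (ρ i) = Q.chartVal i)
    (hu : P.HasOrder (Φ Q.unif) e) : P.HasOrder (Φ φ) (e * k) := by
  obtain ⟨m, n, p, q, rfl, hp, hq, eq⟩ := h
  have hΦ (p : MvPolynomial (Fin 2) ℂ) : Φ (MvPolynomial.aeval Q.chartFun p) =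
      MvPolynomial.aeval P.chartFun (MvPolynomial.bind₁ ρ p) := by
    rw [MvPolynomial.aeval_bind₁, ← AlgHom.comp_apply, MvPolynomial.comp_aeval]
    simp only [hρ]
  have hev (p : MvPolynomial (Fin 2) ℂ) : MvPolynomial.eval P.chartVal (MvPolynomial.bind₁ ρ p) =
      MvPolynomial.eval Q.chartVal p := by
    have := MvPolynomial.aeval_bind₁ P.chartVal ρ p
    simpa [MvPolynomial.aeval_eq_eval, hv] using this
  have eq' := congrArg Φ eq
  simp only [map_mul, map_pow, hΦ] at eq'
  have h1 := HasOrder.aeval (P := P) (p := MvPolynomial.bind₁ ρ p) (by rwa [hev])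
  have h2 := HasOrder.aeval (P := P) (p := MvPolynomial.bind₁ ρ q) (by rwa [hev])
  have h3 := h1.mul (hu.pow m)
  rw [← eq'] at h3
  convert h2.of_mul ((hu.pow n).of_mul h3) using 1
  ring

end Point

/-! ### Fibers of the `x`-coordinate and torsion differences -/

section Fiber

variable {f : ℂ[X]} {g : ℕ}

open Point

/-- The fiber of `xMap` through `P`, as a divisor. -/
def xFiber (P : Point f g) : Point f g →₀ ℤ := Finsupp.single P 1 + Finsupp.single P.invol 1

theorem xFiber_apply_of_xMap_ne {P R : Point f g} (h : R.xMap ≠ P.xMap) : xFiber P R = 0 := by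
  have h1 : P ≠ R := by rintro rfl; exact h rfl
  have h2 : P.invol ≠ R := by rintro rfl; exact h (by cases P <;> rfl)
  simp [xFiber, h1, h2]

-- The common count of a sign fiber with multiplicity, used for `xMap`, `psi` and `psi'`.
open Classical in
theorem ite_eq_add_ite_neg_eq (b d : ℂ) :
    (if b = d then 1 else 0) + (if -b = d then 1 else 0) =
      if b ^ 2 = d ^ 2 then if d = 0 then (2 : ℤ) else 1 else 0 := by
  by_cases h0 : d = 0
  · by_cases hb : b = 0 <;> simp [h0, hb]
  by_cases hb : b ^ 2 = d ^ 2
  · rcases sq_eq_sq_iff_eq_or_eq_neg.1 hb with h | h <;> simp [h, h0, neg_eq_self]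
  · have h1 : b ≠ d := by rintro rfl; exact hb rfl
    have h2 : -b ≠ d := by rintro rfl; exact hb (neg_sq b).symm
    simp [h1, h2, hb]

theorem xFiber_apply_of_xMap_eq {P R : Point f g} (h : R.xMap = P.xMap) :
    xFiber P R = R.xRamification := by
  classical
  have key (b d : ℂ) (hbd : b ^ 2 = d ^ 2) :
      (if b = d then 1 else 0) + (if -b = d then 1 else 0) = if d = 0 then (2 : ℤ) else 1 := by
    rw [ite_eq_add_ite_neg_eq, if_pos hbd]
  cases P with
  | affine a b e =>
    cases R with
    | affine c d e' =>
      obtain rfl : c = a := by simpa [xMap] using h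
      have := key b d (e.trans e'.symm)
      simpa [xFiber, xRamification, Finsupp.single_apply, invol, chartVal] using this
    | infty d e' => simp [xMap] at h
  | infty b e =>
    cases R with
    | affine c d e' => simp [xMap] at h
    | infty d e' =>
      have := key b d (e.trans e'.symm)
      simpa [xFiber, xRamification, Finsupp.single_apply, invol, chartVal] using this

/-- The order of the pole of `x` at `R`. -/
def Point.xPole (R : Point f g) : ℤ :=
  open Classical in if R.xMap = OnePoint.infty then R.xRamification else 0

/-- The function is `x - a` over a finite `a`. Over `∞` the fiber is the polar divisor of `x`
itself, so the constant `1` serves. -/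
theorem exists_hasOrder_xFiber (hf : IsSmoothModel f g) (P : Point f g) :
    ∃ φ : FunField f, IsUnit φ ∧ ∀ R : Point f g, R.HasOrder φ (xFiber P R - R.xPole) := by
  cases P with
  | affine a b e =>
    refine ⟨algebraMap (RatFunc ℂ) _ (algebraMap ℂ[X] _ (X - C a)),
      isUnit_algebraMap_ratFunc (RatFunc.algebraMap_ne_zero (X_sub_C_ne_zero a)), fun R => ?_⟩
    cases R with
    | affine c d e' =>
      rw [xPole, if_neg (by simp [xMap]), sub_zero]
      have hx : algebraMap (RatFunc ℂ) (FunField f) (algebraMap ℂ[X] _ (X - C a)) =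
          aeval ((affine c d e' : Point f g).chartFun 0) (X - C a) := by
        rw [aeval_chartFun_zero, base, aeval_ratFunc_X]
      rw [hx]
      by_cases hca : c = a
      · subst hca
        rw [xFiber_apply_of_xMap_eq (by rfl)]
        simpa [chartVal] using hasOrder_chartFun_zero_sub hf (affine c d e' : Point f g)
      · rw [xFiber_apply_of_xMap_ne (by simpa [xMap] using hca)]
        refine HasOrder.polynomial_zero ?_
        simpa [chartVal, sub_eq_zero] using hca
    | infty d e' =>
      rw [xPole, if_pos (by rfl), xFiber_apply_of_xMap_ne (by simp [xMap])]
      have hs := hasOrder_chartFun_zero_sub hf (infty d e' : Point f g)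
      -- With `s = 1/x`, `(x - a) s = 1 - a s`, which is `1` at infinity.
      refine hs.of_mul ?_
      have := HasOrder.polynomial_zero (P := (infty d e' : Point f g)) (A := 1 - C a * X)
        (by simp [chartVal])
      convert this using 1
      rw [aeval_chartFun_zero, chartFun_zero]
      simp only [chartVal, Matrix.cons_val_zero, map_zero, sub_zero, base]
      rw [← map_mul]
      congr 1
      have hX : (RatFunc.X : RatFunc ℂ) ≠ 0 := RatFunc.X_ne_zero
      simp
      field_simp
  | infty b e =>
    refine ⟨1, isUnit_one, fun R => ?_⟩
    convert HasOrder.one using 1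
    cases R with
    | affine c d e' =>
      rw [xPole, if_neg (by simp [xMap]), sub_zero, xFiber_apply_of_xMap_ne (by simp [xMap])]
    | infty d e' => rw [xPole, if_pos (by rfl), xFiber_apply_of_xMap_eq (by rfl), sub_self]

theorem xFiber_sub_xFiber_mem (hf : IsSmoothModel f g) (P Q : Point f g) :
    xFiber P - xFiber Q ∈ principal f g := by
  obtain ⟨φ, hφ, h⟩ := exists_hasOrder_xFiber hf P
  obtain ⟨ψ, hψ, h'⟩ := exists_hasOrder_xFiber hf Q
  obtain ⟨χ, hχ⟩ := hψ.exists_right_inv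
  refine ⟨φ * χ, hφ.mul (IsUnit.of_mul_eq_one ψ (by rw [mul_comm, hχ])), fun R => ?_⟩
  have := (h' R).of_mul (φ := φ * χ) (k := xFiber P R - R.xPole) (by
    rw [mul_assoc, mul_comm χ, hχ, mul_one]; exact h R)
  convert this using 1
  rw [Finsupp.sub_apply]; ring

/-- A divisor with a positive multiple that is principal. -/
def IsTorsionDivisor (D : Point f g →₀ ℤ) : Prop := ∃ n : ℕ, 0 < n ∧ n • D ∈ principal f g

theorem isOfFinAddOrder_diff_iff {P Q : Point f g} : IsOfFinAddOrder (diff P Q) ↔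
    IsTorsionDivisor (Finsupp.single P 1 - Finsupp.single Q 1) := by
  rw [isOfFinAddOrder_iff_nsmul_eq_zero]
  refine exists_congr fun n => and_congr_right fun _ => ?_
  rw [diff, ← QuotientAddGroup.mk_nsmul, QuotientAddGroup.eq_zero_iff,
    AddSubgroup.mem_addSubgroupOf]
  rfl

namespace IsTorsionDivisor

variable {D D' : Point f g →₀ ℤ}

theorem of_mem (h : D ∈ principal f g) : IsTorsionDivisor D := ⟨1, one_pos, by rwa [one_smul]⟩

theorem add (h : IsTorsionDivisor D) (h' : IsTorsionDivisor D') : IsTorsionDivisor (D + D') := by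
  obtain ⟨n, hn, h⟩ := h
  obtain ⟨m, hm, h'⟩ := h'
  refine ⟨n * m, Nat.mul_pos hn hm, ?_⟩
  rw [smul_add]
  refine add_mem ?_ ?_
  · rw [mul_comm, mul_smul]; exact nsmul_mem h m
  · rw [mul_smul]; exact nsmul_mem h' n

theorem neg (h : IsTorsionDivisor D) : IsTorsionDivisor (-D) := by
  obtain ⟨n, hn, h⟩ := h
  exact ⟨n, hn, by rw [smul_neg]; exact neg_mem h⟩

theorem of_nsmul {k : ℕ} (hk : 0 < k) (h : IsTorsionDivisor (k • D)) : IsTorsionDivisor D := by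
  obtain ⟨n, hn, h⟩ := h
  exact ⟨n * k, Nat.mul_pos hn hk, by rwa [mul_smul]⟩

end IsTorsionDivisor

theorem isOfFinAddOrder_diff_self (P : Point f g) : IsOfFinAddOrder (diff P P) := by
  rw [isOfFinAddOrder_diff_iff, sub_self]
  exact .of_mem (zero_mem _)

theorem isOfFinAddOrder_diff_symm {P Q : Point f g} (h : IsOfFinAddOrder (diff P Q)) :
    IsOfFinAddOrder (diff Q P) := by
  rw [isOfFinAddOrder_diff_iff] at h ⊢
  simpa using h.neg

theorem isOfFinAddOrder_diff_trans {P Q R : Point f g} (h : IsOfFinAddOrder (diff P Q))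
    (h' : IsOfFinAddOrder (diff Q R)) : IsOfFinAddOrder (diff P R) := by
  rw [isOfFinAddOrder_diff_iff] at h h' ⊢
  simpa using h.add h'

theorem isOfFinAddOrder_diff_of_mem_ramification (hf : IsSmoothModel f g) {P Q : Point f g}
    (hP : P ∈ ramification f g) (hQ : Q ∈ ramification f g) : IsOfFinAddOrder (diff P Q) := by
  have h := xFiber_sub_xFiber_mem hf P Q
  rw [ramification, Set.mem_ofPred_eq] at hP hQ
  rw [xFiber, xFiber, hP, hQ] at h
  rw [isOfFinAddOrder_diff_iff]
  -- The fiber through a ramification point is twice that point.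
  refine .of_nsmul (k := 2) two_pos (.of_mem ?_)
  convert h using 1
  abel

/-- `P + P.invol` is linearly equivalent to `2 O`, so `P.invol - O` is equivalent to `-(P - O)`. -/
theorem isOfFinAddOrder_diff_invol (hf : IsSmoothModel f g) {P O : Point f g}
    (hO : O ∈ ramification f g) (h : IsOfFinAddOrder (diff P O)) :
    IsOfFinAddOrder (diff P.invol O) := by
  have h1 := xFiber_sub_xFiber_mem hf P O
  rw [ramification, Set.mem_ofPred_eq] at hO
  rw [xFiber, xFiber, hO] at h1
  rw [isOfFinAddOrder_diff_iff] at h ⊢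
  convert (IsTorsionDivisor.of_mem h1).add h.neg using 1
  abel

theorem Point.eq_or_eq_invol_of_xMap_eq {P Q : Point f g} (h : P.xMap = Q.xMap) :
    P = Q ∨ P = Q.invol := by
  cases P with
  | affine a b e =>
    cases Q with
    | affine c d e' =>
      obtain rfl : a = c := by simpa [xMap] using h
      simpa [invol] using sq_eq_sq_iff_eq_or_eq_neg.1 (e.trans e'.symm)
    | infty d e' => simp [xMap] at h
  | infty b e =>
    cases Q with
    | affine c d e' => simp [xMap] at h
    | infty d e' => simpa [invol] using sq_eq_sq_iff_eq_or_eq_neg.1 (e.trans e'.symm)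

end Fiber

theorem xMap_mem_image_torsionPoints {f : ℂ[X]} (hf : IsSmoothModel f 1) {O : Point f 1}
    (hO : O ∈ Point.ramification f 1) {P : Point f 1} :
    P.xMap ∈ Point.xMap '' torsionPoints O ↔ IsOfFinAddOrder (diff P O) := by
  refine ⟨?_, fun h => ⟨P, h, rfl⟩⟩
  rintro ⟨Q, hQ, e⟩
  rcases Point.eq_or_eq_invol_of_xMap_eq e.symm with rfl | rfl
  · exact hQ
  · exact isOfFinAddOrder_diff_invol hf hO hQ

/-! ### Torsion under the quotient by an involution -/

section Quotient

variable {f₁ f₂ : ℂ[X]} {g₁ g₂ : ℕ}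

/-- The map `q` is the quotient of the curve `y² = f₂(x)` by the involution `τ`, with ramification
indices `e`; `Φ` and `S` are the pullbacks of functions along `q` and `τ`. -/
structure IsInvolutionQuotient (q : Point f₂ g₂ → Point f₁ g₁) (τ : Point f₂ g₂ → Point f₂ g₂)
    (e : Point f₂ g₂ → ℤ) (Φ : FunField f₁ →ₐ[ℂ] FunField f₂)
    (S : FunField f₂ →ₐ[ℂ] FunField f₂) : Prop where
  surjective : Function.Surjective q
  involutive : Function.Involutive τ
  ne_zero : ∀ R, e R ≠ 0
  fiber : ∀ P R, e R * Finsupp.single (q P) (1 : ℤ) (q R) =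
    Finsupp.single P (1 : ℤ) R + Finsupp.single (τ P) (1 : ℤ) R
  hasOrder_quotient : ∀ R φ k, (q R).HasOrder φ k → R.HasOrder (Φ φ) (e R * k)
  hasOrder_involution : ∀ R φ k, (τ R).HasOrder φ k → R.HasOrder (S φ) k
  isUnit_of_isUnit : ∀ φ, IsUnit (Φ φ) → IsUnit φ
  exists_eq_mul : ∀ φ, ∃ φ₀, Φ φ₀ = φ * S φ

namespace IsInvolutionQuotient

variable {q : Point f₂ g₂ → Point f₁ g₁} {τ : Point f₂ g₂ → Point f₂ g₂} {e : Point f₂ g₂ → ℤ}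
  {Φ : FunField f₁ →ₐ[ℂ] FunField f₂} {S : FunField f₂ →ₐ[ℂ] FunField f₂}

/-- If `φ` has divisor `n (q P - q W)`, then `Φ φ` has the pullback of that divisor; by `fiber`, the
pullback of `q P` is `P + τ P`. -/
theorem isTorsionDivisor_preimage (h : IsInvolutionQuotient q τ e Φ S) {P W : Point f₂ g₂}
    (hPW : IsOfFinAddOrder (diff (q P) (q W))) :
    IsTorsionDivisor (Finsupp.single P (1 : ℤ) + Finsupp.single (τ P) 1 -
      (Finsupp.single W 1 + Finsupp.single (τ W) 1)) := by
  obtain ⟨n, hn, φ, hφ, ho⟩ := isOfFinAddOrder_diff_iff.1 hPW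
  refine ⟨n, hn, Φ φ, hφ.map Φ, fun R => ?_⟩
  convert h.hasOrder_quotient R φ _ (ho (q R)) using 1
  simp only [Finsupp.smul_apply, Finsupp.sub_apply, Finsupp.add_apply, ← h.fiber, nsmul_eq_mul]
  ring

/-- Pushforward by the norm: `φ * S φ` descends to a function `φ₀` whose divisor is the image under
`q` of that of `φ`. -/
theorem isOfFinAddOrder_image (h : IsInvolutionQuotient q τ e Φ S) (hf₁ : IsSmoothModel f₁ g₁)
    (hf₂ : IsSmoothModel f₂ g₂) {P W : Point f₂ g₂} (hPW : IsOfFinAddOrder (diff P W)) :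
    IsOfFinAddOrder (diff (q P) (q W)) := by
  obtain ⟨n, hn, φ, hφ, ho⟩ := isOfFinAddOrder_diff_iff.1 hPW
  obtain ⟨φ₀, hφ₀⟩ := h.exists_eq_mul φ
  have hu : IsUnit φ₀ := h.isUnit_of_isUnit φ₀ (hφ₀ ▸ hφ.mul (hφ.map S))
  refine isOfFinAddOrder_diff_iff.2 ⟨n, hn, φ₀, hu, fun Q => ?_⟩
  obtain ⟨R, rfl⟩ := h.surjective Q
  obtain ⟨k, hk⟩ := (q R).exists_hasOrder hf₁ hu
  convert hk using 1
  -- The order of `Φ φ₀` at `R` is `e R` times that of `φ₀` at `q R`, and also the sum of the orders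
  -- of `φ` at `R` and `τ R`.
  refine mul_left_cancel₀ (h.ne_zero R) ?_
  have h1 := h.hasOrder_quotient R φ₀ k hk
  rw [hφ₀] at h1
  rw [← ((ho R).mul (h.hasOrder_involution R φ _ (ho (τ R)))).unique hf₂ h1]
  have hτ (P : Point f₂ g₂) :
      Finsupp.single P (1 : ℤ) (τ R) = Finsupp.single (τ P) (1 : ℤ) R := by
    classical
    rw [Finsupp.single_apply, Finsupp.single_apply]
    congr 1
    exact propext ⟨fun h' => by rw [h', h.involutive], fun h' => by rw [← h', h.involutive]⟩
  simp only [Finsupp.smul_apply, Finsupp.sub_apply, nsmul_eq_mul, hτ]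
  linear_combination (n : ℤ) * (h.fiber P R - h.fiber W R)

end IsInvolutionQuotient

end Quotient

/-! ### Descent of invariant functions to the quotients -/

section Descent

theorem coeff_comp_neg_X (p : ℂ[X]) (n : ℕ) : (p.comp (-X)).coeff n = (-1) ^ n * p.coeff n := by
  rw [show (-X : ℂ[X]) = C (-1) * X by simp, comp_C_mul_X_coeff, mul_comm]

theorem exists_eq_comp_X_sq {p : ℂ[X]} (hp : p.comp (-X) = p) : ∃ q : ℂ[X], p = q.comp (X ^ 2) := by
  refine ⟨p.contract 2, ?_⟩
  rw [← expand_eq_comp_X_pow]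
  ext n
  rw [coeff_expand two_pos, coeff_contract two_ne_zero]
  split_ifs with h
  · rw [Nat.div_mul_cancel h]
  · have := congrArg (fun q => coeff q n) hp
    rw [coeff_comp_neg_X, (Nat.not_even_iff_odd.1 fun h' => h h'.two_dvd).neg_one_pow] at this
    linear_combination (-this) / 2

theorem exists_eq_X_mul_comp_X_sq {p : ℂ[X]} (hp : p.comp (-X) = -p) :
    ∃ q : ℂ[X], p = X * q.comp (X ^ 2) := by
  have h0 : p.coeff 0 = 0 := by
    have := congrArg (fun q => coeff q 0) hp
    rw [coeff_comp_neg_X, coeff_neg] at this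
    linear_combination this / 2
  obtain ⟨r, rfl⟩ := X_dvd_iff.2 h0
  rw [mul_comp, X_comp, neg_mul, neg_inj] at hp
  obtain ⟨q, hq⟩ := exists_eq_comp_X_sq (mul_left_cancel₀ X_ne_zero hp)
  exact ⟨q, by rw [← hq]⟩

variable {f₁ f₂ : ℂ[X]}

theorem isUnit_algebraMap_polynomial {f D : ℂ[X]} (hD : D ≠ 0) :
    IsUnit (algebraMap ℂ[X] (FunField f) D) :=
  Point.isUnit_algebraMap_ratFunc (f := f) (RatFunc.algebraMap_ne_zero hD)

theorem pullback_algebraMap_polynomial (r c : ℂ[X]) (hr : 0 < r.natDegree)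
    (h : c ^ 2 * f₂ = f₁.comp r) (p : ℂ[X]) :
    pullback r c hr h (algebraMap ℂ[X] (FunField f₁) p) =
      algebraMap ℂ[X] (FunField f₂) (p.comp r) := by
  have := pullback_algebraMap r c hr h (algebraMap ℂ[X] (RatFunc ℂ) p)
  rwa [ratFuncComp_algebraMap] at this

theorem omega_sq_eq_algebraMap (f : ℂ[X]) :
    (omega : FunField f) ^ 2 = algebraMap ℂ[X] (FunField f) f := Point.omega_sq

theorem exists_mul_algebraMap_eq {f : ℂ[X]} (φ : FunField f) : ∃ A B D : ℂ[X], D ≠ 0 ∧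
    φ * algebraMap ℂ[X] (FunField f) D =
      algebraMap ℂ[X] (FunField f) A + algebraMap ℂ[X] (FunField f) B * omega := by
  obtain ⟨b, hb⟩ := IsAlgClosed.exists_pow_nat_eq (f.eval 0) two_pos
  obtain ⟨A, B, D, hD, h⟩ := (Point.affine 0 b hb : Point f 0).exists_mul_aeval_chartFun φ
  refine ⟨A, B, D, hD, ?_⟩
  simp only [Point.aeval_chartFun_zero, Point.base, aeval_ratFunc_X] at h
  exact h

theorem exists_pullback_eq (r c : ℂ[X]) (hr : 0 < r.natDegree) (h : c ^ 2 * f₂ = f₁.comp r)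
    {χ : FunField f₂} {M N E : ℂ[X]} (hE : E.comp r ≠ 0)
    (hχ : χ * algebraMap ℂ[X] (FunField f₂) (E.comp r) = algebraMap ℂ[X] (FunField f₂) (M.comp r) +
      algebraMap ℂ[X] (FunField f₂) (c * N.comp r) * omega) :
    ∃ φ₀, pullback r c hr h φ₀ = χ := by
  have hE0 : E ≠ 0 := by rintro rfl; simp at hE
  obtain ⟨E', hE'⟩ := (isUnit_algebraMap_polynomial (f := f₁) hE0).exists_right_inv
  refine ⟨(algebraMap ℂ[X] (FunField f₁) M + algebraMap ℂ[X] (FunField f₁) N * omega) * E', ?_⟩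
  have h1 := congrArg (pullback r c hr h) hE'
  rw [map_mul, map_one, pullback_algebraMap_polynomial] at h1
  have h2 : pullback r c hr h omega = algebraMap ℂ[X] (FunField f₂) c * omega :=
    pullback_omega r c hr h
  rw [map_mul] at hχ
  rw [map_mul, map_add, map_mul, pullback_algebraMap_polynomial, pullback_algebraMap_polynomial, h2]
  linear_combination χ * h1 - pullback r c hr h E' * hχ

/-- Put `φ = (A + B y)/D` and multiply by its conjugate under `(x, y) ↦ (-x, ε y)`. The denominator
and the constant term become even in `x`, while the coefficient of `y` gets the factor `ε` under `x
↦ -x`. The hypothesis `hc` says that it then has the form `c · N(x²)`, with `c = 1` for `ε = 1` and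
`c = x` for `ε = -1` in the applications. -/
theorem exists_pullback_eq_mul_pullback_neg {c : ℂ[X]} {ε : ℂ} (h : c ^ 2 * f₂ = f₁.comp (X ^ 2))
    (h' : (C ε) ^ 2 * f₂ = f₂.comp (-X)) (hε : ε ^ 2 = 1) (hr : 0 < (X ^ 2 : ℂ[X]).natDegree)
    (hr' : 0 < (-X : ℂ[X]).natDegree)
    (hc : ∀ p : ℂ[X], p.comp (-X) = C ε * p → ∃ q : ℂ[X], p = c * q.comp (X ^ 2))
    (φ : FunField f₂) :
    ∃ φ₀, pullback (X ^ 2) c hr h φ₀ = φ * pullback (-X) (C ε) hr' h' φ := by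
  have hεC : (C ε : ℂ[X]) ^ 2 = 1 := by rw [← Polynomial.C_pow, hε, Polynomial.C_1]
  have hf₂ : f₂.comp (-X) = f₂ := by rw [← h', hεC, one_mul]
  obtain ⟨A, B, D, hD, e⟩ := exists_mul_algebraMap_eq φ
  have hD' : D.comp (-X) ≠ 0 := fun h0 => hD (by rw [← comp_neg_X_comp_neg_X D, h0, zero_comp])
  obtain ⟨E, hE⟩ := exists_eq_comp_X_sq (p := D * D.comp (-X)) (by
    rw [mul_comp, comp_neg_X_comp_neg_X]; ring)
  obtain ⟨M, hM⟩ := exists_eq_comp_X_sq (p := A * A.comp (-X) + C ε * B * B.comp (-X) * f₂) (by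
    simp only [mul_comp, add_comp, comp_neg_X_comp_neg_X, hf₂, C_comp]; ring)
  obtain ⟨N, hN⟩ := hc (C ε * A * B.comp (-X) + A.comp (-X) * B) (by
    simp only [mul_comp, add_comp, comp_neg_X_comp_neg_X, C_comp]
    linear_combination (-A * B.comp (-X)) * hεC)
  refine exists_pullback_eq (E := E) (M := M) (N := N) (X ^ 2) c hr h (hE ▸ mul_ne_zero hD hD') ?_
  have e' := congrArg (pullback (-X) (C ε) hr' h') e
  have h2 : pullback (-X) (C ε) hr' h' omega = algebraMap ℂ[X] (FunField f₂) (C ε) * omega :=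
    pullback_omega _ _ _ _
  simp only [map_mul, map_add, pullback_algebraMap_polynomial, h2] at e'
  rw [← hE, ← hM, ← hN]
  simp only [map_mul, map_add]
  rw [← omega_sq_eq_algebraMap]
  set i := algebraMap ℂ[X] (FunField f₂)
  linear_combination (pullback (-X) (C ε) hr' h' φ * i (D.comp (-X))) * e +
    (i A + i B * omega) * e'

end Descent

/-! ### Smoothness of the three models -/

section Smooth

variable {u v w : ℂ}

theorem eval_polyE (a : ℂ) : (polyE u v w).eval a = (a - u) * (a - v) * (a - w) := by
  simp [polyE]

theorem eval_polyE' (a : ℂ) : (polyE' u v w).eval a = a * (a - u) * (a - v) * (a - w) := by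
  simp [polyE']

theorem eval_polyC (a : ℂ) :
    (polyC u v w).eval a = (a ^ 2 - u) * (a ^ 2 - v) * (a ^ 2 - w) := by
  simp [polyC]

theorem polyC_eq_comp : polyC u v w = (polyE u v w).comp (X ^ 2) := by
  simp [polyC, polyE]

theorem X_sq_mul_polyC_eq_comp : X ^ 2 * polyC u v w = (polyE' u v w).comp (X ^ 2) := by
  simp [polyC, polyE']; ring

theorem polyC_comp_neg_X : (polyC u v w).comp (-X) = polyC u v w := by
  simp [polyC]

theorem eval_derivative_polyE_ne_zero (huv : u ≠ v) (huw : u ≠ w) (hvw : v ≠ w) {a : ℂ}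
    (ha : (polyE u v w).eval a = 0) : (polyE u v w).derivative.eval a ≠ 0 := by
  rw [eval_polyE, mul_eq_zero, mul_eq_zero, sub_eq_zero, sub_eq_zero, sub_eq_zero] at ha
  have hd : (polyE u v w).derivative.eval a =
      (a - v) * (a - w) + (a - u) * (a - w) + (a - u) * (a - v) := by
    simp [polyE]; ring
  rw [hd]
  rcases ha with (rfl | rfl) | rfl
  · simpa [sub_eq_zero] using And.intro huv huw
  · simpa [sub_eq_zero] using And.intro huv.symm hvw
  · simpa [sub_eq_zero] using And.intro huw.symm hvw.symm

theorem isSmoothModel_polyE (huv : u ≠ v) (huw : u ≠ w) (hvw : v ≠ w) :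
    IsSmoothModel (polyE u v w) 1 where
  natDegree_le := by
    have : (polyE u v w).natDegree ≤ 3 := by unfold polyE; compute_degree
    omega
  eval_derivative_ne_zero _ := eval_derivative_polyE_ne_zero huv huw hvw
  coeff_ne_zero _ := by
    have : (polyE u v w).coeff (2 * 1 + 1) = 1 := by unfold polyE; compute_degree!
    rw [this]; exact one_ne_zero

theorem isSmoothModel_polyE' (hu : u ≠ 0) (hv : v ≠ 0) (hw : w ≠ 0)
    (huv : u ≠ v) (huw : u ≠ w) (hvw : v ≠ w) : IsSmoothModel (polyE' u v w) 1 where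
  natDegree_le := by unfold polyE'; compute_degree
  eval_derivative_ne_zero a ha := by
    have hE : polyE' u v w = X * polyE u v w := by rw [polyE', polyE]; ring
    rw [hE, eval_mul, eval_X, mul_eq_zero] at ha
    rw [hE, derivative_mul, derivative_X, one_mul, eval_add, eval_mul, eval_X]
    rcases ha with rfl | ha
    · simpa [eval_polyE] using And.intro (And.intro hu hv) hw
    · rw [ha, zero_add]
      refine mul_ne_zero ?_ (eval_derivative_polyE_ne_zero huv huw hvw ha)
      rintro rfl
      simp [eval_polyE, hu, hv, hw] at ha
  coeff_ne_zero h := by rw [coeff_polyE'] at h; exact absurd h one_ne_zero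

theorem isSmoothModel_polyC (hu : u ≠ 0) (hv : v ≠ 0) (hw : w ≠ 0)
    (huv : u ≠ v) (huw : u ≠ w) (hvw : v ≠ w) : IsSmoothModel (polyC u v w) 2 where
  natDegree_le := by unfold polyC; compute_degree
  eval_derivative_ne_zero a ha := by
    rw [polyC_eq_comp, eval_comp, eval_pow, eval_X] at ha
    rw [polyC_eq_comp, derivative_comp]
    have ha0 : a ≠ 0 := by
      rintro rfl
      simp [eval_polyE, hu, hv, hw] at ha
    have := eval_derivative_polyE_ne_zero huv huw hvw ha
    simpa [eval_comp, ha0] using this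
  coeff_ne_zero h := by rw [coeff_polyC] at h; exact absurd h one_ne_zero

end Smooth

/-! ### The involutions `(x, y) ↦ (-x, ±y)` of `C` -/

section Involution

variable {u v w : ℂ}

/-- The involution `(x, y) ↦ (-x, ε y)` of `C`, for `ε = ±1`. -/
def negX {ε : ℂ} (hε : ε ^ 2 = 1) : Point (polyC u v w) 2 → Point (polyC u v w) 2
  | .affine a b h => .affine (-a) (ε * b) (by rw [mul_pow, hε, one_mul, h]; simp [eval_polyC])
  -- The coordinate is `y/x³`, and `x³` changes sign.
  | .infty b h => .infty (-(ε * b)) (by rw [neg_sq, mul_pow, hε, one_mul, h])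

theorem negX_involutive {ε : ℂ} (hε : ε ^ 2 = 1) :
    Function.Involutive (negX (u := u) (v := v) (w := w) hε) := by
  have h (b : ℂ) : ε * (ε * b) = b := by rw [← mul_assoc, ← sq, hε, one_mul]
  intro P
  cases P <;> simp [negX, h]

theorem natDegree_neg_X_pos : 0 < (-X : ℂ[X]).natDegree := by simp

theorem natDegree_X_sq_pos : 0 < (X ^ 2 : ℂ[X]).natDegree := by simp

theorem C_sq_mul_polyC {ε : ℂ} (hε : ε ^ 2 = 1) :
    (C ε) ^ 2 * polyC u v w = (polyC u v w).comp (-X) := by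
  rw [← Polynomial.C_pow, hε, Polynomial.C_1, one_mul, polyC_comp_neg_X]

theorem ratFuncComp_X (r : ℂ[X]) (hr : 0 < r.natDegree) :
    ratFuncComp r hr RatFunc.X = algebraMap ℂ[X] (RatFunc ℂ) r := by
  rw [← RatFunc.algebraMap_X, ratFuncComp_algebraMap, X_comp]

theorem Point.HasOrder.const_mul {f : ℂ[X]} {g : ℕ} {P : Point f g}
    {φ : FunField f} {k : ℤ} (h : P.HasOrder φ k) {a : ℂ} (ha : a ≠ 0) :
    P.HasOrder (algebraMap ℂ (FunField f) a * φ) k := by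
  have := Point.HasOrder.aeval (P := P) (p := MvPolynomial.C a) (by simpa using ha)
  simpa using this.mul h

/-- In each chart the involution only rescales the coordinates by nonzero constants, so it takes
uniformizers to multiples of uniformizers and preserves orders. -/
theorem pullback_chartFun_negX {ε : ℂ} (hε : ε ^ 2 = 1) (P : Point (polyC u v w) 2) (i : Fin 2) :
    ∃ δ : ℂ, δ ≠ 0 ∧ pullback (-X) (C ε) natDegree_neg_X_pos (C_sq_mul_polyC hε)
      ((negX hε P).chartFun i) = algebraMap ℂ _ δ * P.chartFun i ∧
      (negX hε P).chartVal i = δ * P.chartVal i := by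
  have hε0 : ε ≠ 0 := by rintro rfl; norm_num at hε
  fin_cases i
  · refine ⟨-1, by norm_num, ?_, ?_⟩
    · cases P with
      | affine a b h => simp [negX, Point.chartFun, pullback_algebraMap, ratFuncComp_X]
      | infty b h =>
        change pullback (-X) (C ε) _ _ (algebraMap (RatFunc ℂ) _ RatFunc.X⁻¹) =
          algebraMap (RatFunc ℂ) _ (algebraMap ℂ (RatFunc ℂ) (-1)) *
            algebraMap (RatFunc ℂ) _ RatFunc.X⁻¹
        rw [pullback_algebraMap, map_inv₀, ratFuncComp_X, ← map_mul]
        congr 1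
        simp
        ring
    · cases P <;> simp [negX, Point.chartVal]
  · cases P with
    | affine a b h =>
      refine ⟨ε, hε0, ?_, ?_⟩
      · simp [negX, Point.chartFun, pullback_omega]
        rfl
      · simp [negX, Point.chartVal]
    | infty b h =>
      refine ⟨-ε, neg_ne_zero.2 hε0, ?_, ?_⟩
      · change pullback (-X) (C ε) _ _
            (algebraMap (RatFunc ℂ) _ (RatFunc.X⁻¹ ^ (2 + 1)) * omega) =
          algebraMap (RatFunc ℂ) _ (algebraMap ℂ (RatFunc ℂ) (-ε)) *
            (algebraMap (RatFunc ℂ) _ (RatFunc.X⁻¹ ^ (2 + 1)) * omega)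
        rw [map_mul, pullback_algebraMap, pullback_omega, map_pow, map_inv₀, ratFuncComp_X,
          ← mul_assoc, ← mul_assoc, ← map_mul, ← map_mul]
        congr 2
        have hC : algebraMap ℂ[X] (RatFunc ℂ) (C ε) = algebraMap ℂ (RatFunc ℂ) ε := rfl
        rw [hC]
        simp
        ring
      · simp [negX, Point.chartVal]

theorem hasOrder_pullback_negX {ε : ℂ} (hε : ε ^ 2 = 1) (P : Point (polyC u v w) 2)
    {φ : FunField (polyC u v w)} {k : ℤ} (h : (negX hε P).HasOrder φ k) :
    P.HasOrder (pullback (-X) (C ε) natDegree_neg_X_pos (C_sq_mul_polyC hε) φ) k := by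
  choose δ hδ hfun hval using pullback_chartFun_negX hε P
  rw [← one_mul k]
  refine h.map (pullback (-X) (C ε) natDegree_neg_X_pos (C_sq_mul_polyC hε))
    (fun i => MvPolynomial.C (δ i) * MvPolynomial.X i) (fun i => ?_) (fun i => ?_) ?_
  · rw [hfun]; simp
  · rw [hval]; simp
  · have hu := Point.HasOrder.unif (P := P)
    by_cases h0 : P.chartVal 1 = 0
    · rw [Point.unif_of_eq_zero (by rw [hval, h0, mul_zero]), hfun, ← Point.unif_of_eq_zero h0]
      exact hu.const_mul (hδ 1)
    · rw [Point.unif_of_ne_zero (by rw [hval]; exact mul_ne_zero (hδ 1) h0), map_sub, hfun, hval,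
        AlgHom.commutes, map_mul, ← mul_sub, ← Point.unif_of_ne_zero h0]
      exact hu.const_mul (hδ 0)

end Involution

/-! ### Ramification of `psi` and `psi'` -/

section Psi

variable {u v w : ℂ}

theorem one_sq_mul_polyC : 1 ^ 2 * polyC u v w = (polyE u v w).comp (X ^ 2) := by
  rw [one_pow, one_mul, polyC_eq_comp]

/-- The ramification index of `psi`. -/
def psiRamification : Point (polyC u v w) 2 → ℤ
  | .affine a _ _ => open Classical in if a = 0 then 2 else 1
  | .infty _ _ => 1

/-- The ramification index of `psi'`. -/
def psiRamification' : Point (polyC u v w) 2 → ℤ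
  | .affine _ _ _ => 1
  | .infty _ _ => 2

theorem infty_ne_zero {b : ℂ} (h : b ^ 2 = (polyC u v w).coeff (2 * 2 + 2)) : b ≠ 0 := by
  rintro rfl
  rw [coeff_polyC] at h
  norm_num at h

theorem affine_zero_ne_zero (hu : u ≠ 0) (hv : v ≠ 0) (hw : w ≠ 0) {b : ℂ}
    (h : b ^ 2 = (polyC u v w).eval 0) : b ≠ 0 := by
  rintro rfl
  simp [eval_polyC, hu, hv, hw] at h

/-- `s² - a² = (s - a)(s + a)`, and `s + a` takes the value `2a ≠ 0`. -/
theorem hasOrder_X_sq_sub (P : Point (polyC u v w) 2) (hP : P.chartVal 1 ≠ 0)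
    (h0 : P.chartVal 0 ≠ 0) :
    P.HasOrder (P.chartFun 0 ^ 2 - algebraMap ℂ _ (P.chartVal 0 ^ 2)) 1 := by
  have h1 := Point.HasOrder.unif (P := P)
  have h2 := Point.HasOrder.polynomial_zero (P := P) (A := X + C (P.chartVal 0))
    (by simpa [← two_mul] using h0)
  rw [Point.unif_of_ne_zero hP] at h1
  convert h1.mul h2 using 1
  · simp only [map_pow, map_add, aeval_X, aeval_C]
    ring
  · rfl

/-- Ramification occurs exactly at the fixed points of `(x, y) ↦ (-x, y)`, which are those with `x =
0`; there `y ≠ 0` because `u v w ≠ 0`. -/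
theorem hasOrder_pullback_psi (hu : u ≠ 0) (hv : v ≠ 0) (hw : w ≠ 0) (P : Point (polyC u v w) 2)
    {φ : FunField (polyE u v w)} {k : ℤ} (h : (psi P).HasOrder φ k) :
    P.HasOrder (pullback (X ^ 2) 1 natDegree_X_sq_pos one_sq_mul_polyC φ)
      (psiRamification P * k) := by
  cases P with
  | affine a b e =>
    set P : Point (polyC u v w) 2 := .affine a b e with hP
    have hΦ0 : pullback (X ^ 2) 1 natDegree_X_sq_pos one_sq_mul_polyC ((psi P).chartFun 0) =
        P.chartFun 0 ^ 2 := by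
      simp [hP, psi, Point.chartFun, pullback_algebraMap, ratFuncComp_X]
    have hΦ1 : pullback (X ^ 2) 1 natDegree_X_sq_pos one_sq_mul_polyC ((psi P).chartFun 1) =
        P.chartFun 1 := by
      simp [hP, psi, Point.chartFun, pullback_omega]
    refine h.map _ ![MvPolynomial.X 0 ^ 2, MvPolynomial.X 1] ?_ ?_ ?_
    · intro i; fin_cases i <;> simp [hΦ0, hΦ1]
    · intro i; fin_cases i <;> simp [hP, psi, Point.chartVal]
    · by_cases hb : b = 0
      · have ha : a ≠ 0 := fun ha => affine_zero_ne_zero hu hv hw (ha ▸ e) hb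
        rw [Point.unif_of_eq_zero (by simpa [hP, psi, Point.chartVal] using hb), hΦ1,
          ← Point.unif_of_eq_zero (by simpa [hP, Point.chartVal] using hb), psiRamification,
          if_neg ha]
        exact Point.HasOrder.unif
      · have hb' : P.chartVal 1 ≠ 0 := by simpa [hP, Point.chartVal] using hb
        rw [Point.unif_of_ne_zero (by simpa [hP, psi, Point.chartVal] using hb), map_sub,
          AlgHom.commutes, hΦ0, psiRamification]
        by_cases ha : a = 0
        · rw [if_pos ha]
          have := (Point.HasOrder.unif (P := P)).pow 2
          rw [Point.unif_of_ne_zero hb'] at this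
          simpa [hP, psi, Point.chartVal, ha] using this
        · rw [if_neg ha]
          exact hasOrder_X_sq_sub P hb' (by simpa [hP, Point.chartVal] using ha)
  | infty b e =>
    set P : Point (polyC u v w) 2 := .infty b e with hP
    have hb := infty_ne_zero e
    have hb' : P.chartVal 1 ≠ 0 := by simpa [hP, Point.chartVal] using hb
    have hΦ0 : pullback (X ^ 2) 1 natDegree_X_sq_pos one_sq_mul_polyC ((psi P).chartFun 0) =
        P.chartFun 0 ^ 2 := by
      change pullback (X ^ 2) 1 _ _ (algebraMap (RatFunc ℂ) _ RatFunc.X⁻¹) =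
        algebraMap (RatFunc ℂ) _ RatFunc.X⁻¹ ^ 2
      rw [pullback_algebraMap, map_inv₀, ratFuncComp_X, ← map_pow]
      congr 1
      simp
    -- At infinity on `E` the uniformizer `y/x²` becomes `y/x⁴ = (1/x)(y/x³)`, a uniformizer times a
    -- nonvanishing function.
    have hΦ1 : pullback (X ^ 2) 1 natDegree_X_sq_pos one_sq_mul_polyC ((psi P).chartFun 1) =
        P.chartFun 0 * P.chartFun 1 := by
      change pullback (X ^ 2) 1 _ _
          (algebraMap (RatFunc ℂ) _ (RatFunc.X⁻¹ ^ (1 + 1)) * omega) =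
        algebraMap (RatFunc ℂ) _ RatFunc.X⁻¹ *
          (algebraMap (RatFunc ℂ) _ (RatFunc.X⁻¹ ^ (2 + 1)) * omega)
      rw [map_mul, pullback_algebraMap, pullback_omega, map_pow, map_inv₀, ratFuncComp_X,
        ← mul_assoc, ← mul_assoc, ← map_mul, ← map_mul]
      congr 2
      simp
      ring
    refine h.map _ ![MvPolynomial.X 0 ^ 2, MvPolynomial.X 0 * MvPolynomial.X 1] ?_ ?_ ?_
    · intro i; fin_cases i <;> simp [hΦ0, hΦ1]
    · intro i; fin_cases i <;> simp [hP, psi, Point.chartVal]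
    · rw [Point.unif_of_eq_zero (by simp [hP, psi, Point.chartVal]), hΦ1]
      have h1 := Point.HasOrder.unif (P := P)
      have h2 := Point.HasOrder.aeval (P := P) (p := MvPolynomial.X 1) (by simpa using hb')
      rw [Point.unif_of_ne_zero hb'] at h1
      simpa [hP, Point.chartVal, psiRamification] using h1.mul h2

/-- Here the ramification sits at the two points at infinity, where the uniformizer `1/x` of `E'`
becomes `1/x²`. At affine points with `x = 0` or `y = 0` the uniformizer pulls back to `xy`, which
has exactly one vanishing factor. -/
theorem hasOrder_pullback_psi' (hu : u ≠ 0) (hv : v ≠ 0) (hw : w ≠ 0) (P : Point (polyC u v w) 2)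
    {φ : FunField (polyE' u v w)} {k : ℤ} (h : (psi' P).HasOrder φ k) :
    P.HasOrder (pullback (X ^ 2) X natDegree_X_sq_pos X_sq_mul_polyC_eq_comp φ)
      (psiRamification' P * k) := by
  cases P with
  | affine a b e =>
    set P : Point (polyC u v w) 2 := .affine a b e with hP
    have hΦ0 : pullback (X ^ 2) X natDegree_X_sq_pos X_sq_mul_polyC_eq_comp
        ((psi' P).chartFun 0) = P.chartFun 0 ^ 2 := by
      simp [hP, psi', Point.chartFun, pullback_algebraMap, ratFuncComp_X]
    have hΦ1 : pullback (X ^ 2) X natDegree_X_sq_pos X_sq_mul_polyC_eq_comp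
        ((psi' P).chartFun 1) = P.chartFun 0 * P.chartFun 1 := by
      simp [hP, psi', Point.chartFun, pullback_omega]
    refine h.map _ ![MvPolynomial.X 0 ^ 2, MvPolynomial.X 0 * MvPolynomial.X 1] ?_ ?_ ?_
    · intro i; fin_cases i <;> simp [hΦ0, hΦ1]
    · intro i; fin_cases i <;> simp [hP, psi', Point.chartVal]
    · rw [psiRamification']
      have h1 := Point.HasOrder.unif (P := P)
      by_cases hb : b = 0
      · have ha : a ≠ 0 := fun ha => affine_zero_ne_zero hu hv hw (ha ▸ e) hb
        rw [Point.unif_of_eq_zero (by simp [hP, psi', Point.chartVal, hb]), hΦ1]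
        have h2 := Point.HasOrder.aeval (P := P) (p := MvPolynomial.X 0)
          (by simpa [hP, Point.chartVal] using ha)
        rw [Point.unif_of_eq_zero (by simpa [hP, Point.chartVal] using hb)] at h1
        simpa using h2.mul h1
      · have hb' : P.chartVal 1 ≠ 0 := by simpa [hP, Point.chartVal] using hb
        by_cases ha : a = 0
        · rw [Point.unif_of_eq_zero (by simp [hP, psi', Point.chartVal, ha]), hΦ1]
          have h2 := Point.HasOrder.aeval (P := P) (p := MvPolynomial.X 1) (by simpa using hb')
          rw [Point.unif_of_ne_zero hb'] at h1
          simpa [hP, Point.chartVal, ha] using h1.mul h2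
        · rw [Point.unif_of_ne_zero (by simp [hP, psi', Point.chartVal, ha, hb]), map_sub,
            AlgHom.commutes, hΦ0]
          exact hasOrder_X_sq_sub P hb' (by simpa [hP, Point.chartVal] using ha)
  | infty b e =>
    set P : Point (polyC u v w) 2 := .infty b e with hP
    have hb := infty_ne_zero e
    have hb' : P.chartVal 1 ≠ 0 := by simpa [hP, Point.chartVal] using hb
    have hΦ0 : pullback (X ^ 2) X natDegree_X_sq_pos X_sq_mul_polyC_eq_comp
        ((psi' P).chartFun 0) = P.chartFun 0 ^ 2 := by
      change pullback (X ^ 2) X _ _ (algebraMap (RatFunc ℂ) _ RatFunc.X⁻¹) =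
        algebraMap (RatFunc ℂ) _ RatFunc.X⁻¹ ^ 2
      rw [pullback_algebraMap, map_inv₀, ratFuncComp_X, ← map_pow]
      congr 1
      simp
    have hΦ1 : pullback (X ^ 2) X natDegree_X_sq_pos X_sq_mul_polyC_eq_comp
        ((psi' P).chartFun 1) = P.chartFun 1 := by
      change pullback (X ^ 2) X _ _
          (algebraMap (RatFunc ℂ) _ (RatFunc.X⁻¹ ^ (1 + 1)) * omega) =
        algebraMap (RatFunc ℂ) _ (RatFunc.X⁻¹ ^ (2 + 1)) * omega
      rw [map_mul, pullback_algebraMap, pullback_omega, map_pow, map_inv₀, ratFuncComp_X,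
        ← mul_assoc, ← map_mul]
      congr 2
      have hX : (RatFunc.X : RatFunc ℂ) ≠ 0 := RatFunc.X_ne_zero
      simp
      field_simp
    refine h.map _ ![MvPolynomial.X 0 ^ 2, MvPolynomial.X 1] ?_ ?_ ?_
    · intro i; fin_cases i <;> simp [hΦ0, hΦ1]
    · intro i; fin_cases i <;> simp [hP, psi', Point.chartVal]
    · rw [Point.unif_of_ne_zero (by simpa [hP, psi', Point.chartVal] using hb), map_sub,
        AlgHom.commutes, hΦ0, psiRamification']
      have h1 := (Point.HasOrder.unif (P := P)).pow 2
      rw [Point.unif_of_ne_zero hb'] at h1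
      simpa [hP, psi', Point.chartVal] using h1

end Psi

/-! ### The Jacobian of `C` up to isogeny -/

section Quotients

variable {u v w : ℂ}

theorem psi_surjective : Function.Surjective (psi (u := u) (v := v) (w := w)) := by
  intro Q
  cases Q with
  | affine a b h =>
    obtain ⟨c, rfl⟩ := IsAlgClosed.exists_pow_nat_eq a two_pos
    exact ⟨.affine c b (by rw [h, eval_polyE, eval_polyC]), rfl⟩
  | infty b h =>
    obtain rfl : b = 0 := by simpa [coeff_polyE] using h
    exact ⟨.infty 1 (by rw [coeff_polyC]; norm_num), rfl⟩

theorem psi'_surjective : Function.Surjective (psi' (u := u) (v := v) (w := w)) := by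
  intro Q
  cases Q with
  | affine a b h =>
    obtain ⟨c, rfl⟩ := IsAlgClosed.exists_pow_nat_eq a two_pos
    by_cases hc : c = 0
    · subst hc
      obtain ⟨d, hd⟩ := IsAlgClosed.exists_pow_nat_eq ((polyC u v w).eval 0) two_pos
      obtain rfl : b = 0 := by simpa [eval_polyE'] using h
      exact ⟨.affine 0 d hd, by simp [psi']⟩
    · refine ⟨.affine c (b / c) ?_, by simp [psi', mul_div_cancel₀ _ hc]⟩
      rw [div_pow, h, eval_polyE', eval_polyC]
      field_simp
  | infty b h => exact ⟨.infty b (by rw [h, coeff_polyC, coeff_polyE']), rfl⟩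

theorem psi_fiber (P R : Point (polyC u v w) 2) :
    psiRamification R * Finsupp.single (psi P) (1 : ℤ) (psi R) =
      Finsupp.single P (1 : ℤ) R + Finsupp.single (negX (one_pow 2) P) (1 : ℤ) R := by
  classical
  cases P with
  | affine a b h =>
    cases R with
    | affine c d h' =>
      have key := ite_eq_add_ite_neg_eq a c
      by_cases hbd : b = d
      · simpa [psi, negX, psiRamification, Finsupp.single_apply, hbd] using key.symm
      · simp [psi, negX, psiRamification, hbd]
    | infty d h' => simp [psi, negX]
  | infty b h =>
    cases R with
    | affine c d h' => simp [psi, negX]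
    | infty d h' =>
      have key := ite_eq_add_ite_neg_eq b d
      rw [if_pos (h.trans h'.symm), if_neg (infty_ne_zero h')] at key
      simpa [psi, negX, psiRamification, Finsupp.single_apply] using key.symm

theorem neg_one_sq_eq_one : (-1 : ℂ) ^ 2 = 1 := by norm_num

theorem psi'_fiber (hu : u ≠ 0) (hv : v ≠ 0) (hw : w ≠ 0) (P R : Point (polyC u v w) 2) :
    psiRamification' R * Finsupp.single (psi' P) (1 : ℤ) (psi' R) =
      Finsupp.single P (1 : ℤ) R + Finsupp.single (negX neg_one_sq_eq_one P) (1 : ℤ) R := by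
  classical
  cases P with
  | affine a b h =>
    cases R with
    | affine c d h' =>
      simp only [psi', negX, psiRamification', Finsupp.single_apply, Point.affine.injEq, one_mul,
        neg_mul]
      by_cases ha : a = 0
      · subst ha
        have hb := affine_zero_ne_zero hu hv hw h
        by_cases hc : c = 0
        · subst hc
          have key := ite_eq_add_ite_neg_eq b d
          rw [if_pos (h.trans h'.symm), if_neg (affine_zero_ne_zero hu hv hw h')] at key
          simpa using key.symm
        · simp [Ne.symm hc, Ne.symm (pow_ne_zero 2 hc)]
      · by_cases hac : a ^ 2 = c ^ 2
        · rcases sq_eq_sq_iff_eq_or_eq_neg.1 hac with rfl | rfl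
          · simp [ha, neg_eq_self]
          · have hc : c ≠ 0 := by simpa using ha
            have hcc : ¬ -c = c := by simpa [neg_eq_self] using hc
            have hbd : -(c * b) = c * d ↔ -b = d := by
              rw [← mul_neg]; exact mul_right_inj' hc
            simp [hcc, hbd]
        · have h1 : a ≠ c := by rintro rfl; exact hac rfl
          have h2 : -a ≠ c := by rintro rfl; exact hac (neg_sq a).symm
          simp [hac, h1, h2]
    | infty d h' => simp [psi', negX]
  | infty b h =>
    cases R with
    | affine c d h' => simp [psi', negX]
    | infty d h' =>
      -- Both points at infinity are fixed by `(x, y) ↦ (-x, -y)`, so each counts twice.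
      by_cases hbd : b = d <;> simp [psi', negX, psiRamification', hbd]

theorem isInvolutionQuotient_psi (hu : u ≠ 0) (hv : v ≠ 0) (hw : w ≠ 0) :
    IsInvolutionQuotient (psi (u := u) (v := v) (w := w)) (negX (one_pow 2)) psiRamification
      (pullback (X ^ 2) 1 natDegree_X_sq_pos one_sq_mul_polyC)
      (pullback (-X) (C 1) natDegree_neg_X_pos (C_sq_mul_polyC (one_pow 2))) where
  surjective := psi_surjective
  involutive := negX_involutive _
  ne_zero R := by
    cases R
    · rw [psiRamification]; split_ifs <;> norm_num
    · exact one_ne_zero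
  fiber := psi_fiber
  hasOrder_quotient R _ _ h := hasOrder_pullback_psi hu hv hw R h
  hasOrder_involution R _ _ h := hasOrder_pullback_negX (one_pow 2) R h
  isUnit_of_isUnit _ h := isUnit_of_isUnit_pullback _ _ _ _ h
  exists_eq_mul φ := by
    refine exists_pullback_eq_mul_pullback_neg _ _ (one_pow 2) _ _ (fun p hp => ?_) φ
    rw [Polynomial.C_1, one_mul] at hp
    obtain ⟨q, hq⟩ := exists_eq_comp_X_sq hp
    exact ⟨q, by rw [one_mul, ← hq]⟩

theorem isInvolutionQuotient_psi' (hu : u ≠ 0) (hv : v ≠ 0) (hw : w ≠ 0) :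
    IsInvolutionQuotient (psi' (u := u) (v := v) (w := w)) (negX neg_one_sq_eq_one)
      psiRamification' (pullback (X ^ 2) X natDegree_X_sq_pos X_sq_mul_polyC_eq_comp)
      (pullback (-X) (C (-1)) natDegree_neg_X_pos (C_sq_mul_polyC neg_one_sq_eq_one)) where
  surjective := psi'_surjective
  involutive := negX_involutive _
  ne_zero R := by cases R <;> simp [psiRamification']
  fiber := psi'_fiber hu hv hw
  hasOrder_quotient R _ _ h := hasOrder_pullback_psi' hu hv hw R h
  hasOrder_involution R _ _ h := hasOrder_pullback_negX neg_one_sq_eq_one R h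
  isUnit_of_isUnit _ h := isUnit_of_isUnit_pullback _ _ _ _ h
  exists_eq_mul φ := by
    refine exists_pullback_eq_mul_pullback_neg _ _ neg_one_sq_eq_one _ _ (fun p hp => ?_) φ
    rw [Polynomial.C_neg, Polynomial.C_1, neg_one_mul] at hp
    exact exists_eq_X_mul_comp_X_sq hp

theorem isOfFinAddOrder_diff_polyC_iff (hu : u ≠ 0) (hv : v ≠ 0) (hw : w ≠ 0)
    (huv : u ≠ v) (huw : u ≠ w) (hvw : v ≠ w) (P W : Point (polyC u v w) 2) :
    IsOfFinAddOrder (diff P W) ↔ IsOfFinAddOrder (diff (psi P) (psi W)) ∧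
      IsOfFinAddOrder (diff (psi' P) (psi' W)) := by
  have hC := isSmoothModel_polyC hu hv hw huv huw hvw
  have hψ := isInvolutionQuotient_psi hu hv hw
  have hψ' := isInvolutionQuotient_psi' hu hv hw
  refine ⟨fun h => ⟨hψ.isOfFinAddOrder_image (isSmoothModel_polyE huv huw hvw) hC h,
    hψ'.isOfFinAddOrder_image (isSmoothModel_polyE' hu hv hw huv huw hvw) hC h⟩, ?_⟩
  rintro ⟨h, h'⟩
  have hinv (Q : Point (polyC u v w) 2) :
      negX neg_one_sq_eq_one Q = (negX (one_pow 2) Q).invol := by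
    cases Q <;> simp [negX, Point.invol]
  have h1 := hψ.isTorsionDivisor_preimage h
  have h2 := hψ'.isTorsionDivisor_preimage h'
  have h3 := IsTorsionDivisor.of_mem
    (xFiber_sub_xFiber_mem hC (negX (one_pow 2) P) (negX (one_pow 2) W))
  rw [hinv, hinv] at h2
  rw [isOfFinAddOrder_diff_iff]
  refine .of_nsmul two_pos ?_
  -- This is `(1 + σ) + (1 + σι) - (σ + ισ) = 2` applied to `P - W`.
  convert (h1.add h2).add h3.neg using 1
  simp only [xFiber]
  abel

end Quotients

/-! ### The hyperelliptic torsion packet as a preimage -/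

section Packet

/-- Torsion difference is an equivalence relation, so packets are its classes, and the class of one
ramification point contains all of them. -/
theorem isHyperellipticTorsionPacket_iff {f : ℂ[X]} {g : ℕ} (hf : IsSmoothModel f g)
    {W : Point f g} (hW : W ∈ Point.ramification f g) {T : Set (Point f g)} :
    IsHyperellipticTorsionPacket T ↔ T = {P | IsOfFinAddOrder (diff P W)} := by
  have hS : ∀ P ∈ {P | IsOfFinAddOrder (diff P W)}, ∀ Q ∈ {P | IsOfFinAddOrder (diff P W)},
      IsOfFinAddOrder (diff P Q) := fun P hP Q hQ =>
    isOfFinAddOrder_diff_trans hP (isOfFinAddOrder_diff_symm hQ)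
  constructor
  · rintro ⟨⟨hT, hmax⟩, hram⟩
    have hTS : T ⊆ {P | IsOfFinAddOrder (diff P W)} := fun P hP => hT P hP W (hram hW)
    exact hTS.antisymm (hmax hS hTS)
  · rintro rfl
    exact ⟨⟨hS, fun T hT hle P hP => hT P hP W (hle (isOfFinAddOrder_diff_self W))⟩,
      fun P hP => isOfFinAddOrder_diff_of_mem_ramification hf hP hW⟩

variable {u v w : ℂ}

theorem rho_mem_commonTorsion_iff (hu : u ≠ 0) (hv : v ≠ 0) (hw : w ≠ 0)
    (huv : u ≠ v) (huw : u ≠ w) (hvw : v ≠ w)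
    {O : Point (polyE u v w) 1} (hO : O ∈ Point.ramification (polyE u v w) 1)
    {O' : Point (polyE' u v w) 1} (hO' : O' ∈ Point.ramification (polyE' u v w) 1)
    (P : Point (polyC u v w) 2) :
    rho P ∈ commonTorsion O O' ↔
      IsOfFinAddOrder (diff (psi P) O) ∧ IsOfFinAddOrder (diff (psi' P) O') := by
  rw [commonTorsion, Set.mem_inter_iff]
  conv_lhs => rw [rho_eq_xMap_psi']
  rw [xMap_mem_image_torsionPoints (isSmoothModel_polyE' hu hv hw huv huw hvw) hO',
    ← rho_eq_xMap_psi', rho, xMap_mem_image_torsionPoints (isSmoothModel_polyE huv huw hvw) hO]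

theorem mem_ramification_of_chartVal_one_eq_zero {f : ℂ[X]} {g : ℕ} {P : Point f g}
    (h : P.chartVal 1 = 0) : P ∈ Point.ramification f g := by
  change P.invol = P
  cases P <;> simpa [Point.invol, neg_eq_self, Point.chartVal] using h

theorem isHyperellipticTorsionPacket_iff_eq_preimage (hu : u ≠ 0) (hv : v ≠ 0) (hw : w ≠ 0)
    (huv : u ≠ v) (huw : u ≠ w) (hvw : v ≠ w)
    {O : Point (polyE u v w) 1} (hO : O ∈ Point.ramification (polyE u v w) 1)
    {O' : Point (polyE' u v w) 1} (hO' : O' ∈ Point.ramification (polyE' u v w) 1)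
    (T : Set (Point (polyC u v w) 2)) :
    IsHyperellipticTorsionPacket T ↔ T = rho ⁻¹' commonTorsion O O' := by
  have hC := isSmoothModel_polyC hu hv hw huv huw hvw
  have hE := isSmoothModel_polyE huv huw hvw
  have hE' := isSmoothModel_polyE' hu hv hw huv huw hvw
  obtain ⟨c, hc⟩ := IsAlgClosed.exists_pow_nat_eq u two_pos
  -- A ramification point of `C` whose images `(u, 0)` on `E` and `E'` are ramification points, so
  -- they can replace `O` and `O'`.
  let W : Point (polyC u v w) 2 := .affine c 0 (by simp [eval_polyC, hc])
  have hW : W ∈ Point.ramification (polyC u v w) 2 :=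
    mem_ramification_of_chartVal_one_eq_zero (by simp [W, Point.chartVal])
  have hψW : psi W ∈ Point.ramification (polyE u v w) 1 :=
    mem_ramification_of_chartVal_one_eq_zero (by simp [W, psi, Point.chartVal])
  have hψW' : psi' W ∈ Point.ramification (polyE' u v w) 1 :=
    mem_ramification_of_chartVal_one_eq_zero (by simp [W, psi', Point.chartVal])
  have h1 := isOfFinAddOrder_diff_of_mem_ramification hE hψW hO
  have h2 := isOfFinAddOrder_diff_of_mem_ramification hE' hψW' hO'
  rw [isHyperellipticTorsionPacket_iff hC hW]
  suffices h : {P | IsOfFinAddOrder (diff P W)} = rho ⁻¹' commonTorsion O O' by rw [h]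
  ext P
  rw [Set.mem_preimage, rho_mem_commonTorsion_iff hu hv hw huv huw hvw hO hO']
  refine (isOfFinAddOrder_diff_polyC_iff hu hv hw huv huw hvw P W).trans (and_congr ?_ ?_)
  · exact ⟨fun h => isOfFinAddOrder_diff_trans h h1,
      fun h => isOfFinAddOrder_diff_trans h (isOfFinAddOrder_diff_symm h1)⟩
  · exact ⟨fun h => isOfFinAddOrder_diff_trans h h2,
      fun h => isOfFinAddOrder_diff_trans h (isOfFinAddOrder_diff_symm h2)⟩

end Packet

/-! ### Counting points in the fibers of `rho` -/

section Counting

variable {u v w : ℂ}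

theorem rho_surjective : Function.Surjective (rho (u := u) (v := v) (w := w)) := by
  intro z
  induction z using OnePoint.rec with
  | infty => exact ⟨.infty 1 (by rw [coeff_polyC]; norm_num), rfl⟩
  | coe a =>
    obtain ⟨c, hc⟩ := IsAlgClosed.exists_pow_nat_eq a two_pos
    obtain ⟨b, hb⟩ := IsAlgClosed.exists_pow_nat_eq ((polyC u v w).eval c) two_pos
    exact ⟨.affine c b hb, by simp [rho, psi, Point.xMap, hc]⟩

theorem coe_mem_commonTorsion (hu : u ≠ 0) (hv : v ≠ 0) (hw : w ≠ 0)
    (huv : u ≠ v) (huw : u ≠ w) (hvw : v ≠ w)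
    {O : Point (polyE u v w) 1} (hO : O ∈ Point.ramification (polyE u v w) 1)
    {O' : Point (polyE' u v w) 1} (hO' : O' ∈ Point.ramification (polyE' u v w) 1)
    {a : ℂ} (ha : (polyE u v w).eval a = 0) : (a : OnePoint ℂ) ∈ commonTorsion O O' := by
  have ha' : (polyE' u v w).eval a = 0 := by
    rw [eval_polyE] at ha
    rw [eval_polyE']
    linear_combination a * ha
  refine ⟨⟨.affine a 0 (by rw [ha]; norm_num), ?_, rfl⟩,
    ⟨.affine a 0 (by rw [ha']; norm_num), ?_, rfl⟩⟩
  · exact isOfFinAddOrder_diff_of_mem_ramification (isSmoothModel_polyE huv huw hvw)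
      (mem_ramification_of_chartVal_one_eq_zero rfl) hO
  · exact isOfFinAddOrder_diff_of_mem_ramification (isSmoothModel_polyE' hu hv hw huv huw hvw)
      (mem_ramification_of_chartVal_one_eq_zero rfl) hO'

-- The fiber over `a = c²` consists of `(±c, ±b)`; it loses two points if `b = 0` (`a` is `u`, `v`
-- or `w`) or if `c = 0`. These cannot happen together, as `u v w ≠ 0`. The losses are added rather
-- than subtracted to stay in `ℕ`.
open Classical in
theorem exists_finset_eq_rho_fiber (hu : u ≠ 0) (hv : v ≠ 0) (hw : w ≠ 0) (z : OnePoint ℂ) :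
    ∃ F : Finset (Point (polyC u v w) 2), (∀ P, P ∈ F ↔ rho P = z) ∧
      F.card + 2 * (if z ∈ ({(u : OnePoint ℂ), (v : OnePoint ℂ), (w : OnePoint ℂ)} :
        Finset (OnePoint ℂ)) then 1 else 0) +
      2 * (if z ∈ ({((0 : ℂ) : OnePoint ℂ), OnePoint.infty} : Finset (OnePoint ℂ))
        then 1 else 0) = 4 := by
  induction z using OnePoint.rec with
  | infty =>
    refine ⟨{.infty 1 (by rw [coeff_polyC]; norm_num), .infty (-1) (by rw [coeff_polyC]; norm_num)},
      fun P => ?_, ?_⟩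
    · cases P with
      | affine a b h => simp [rho, psi, Point.xMap]
      | infty b h =>
        rw [coeff_polyC, ← one_pow 2, sq_eq_sq_iff_eq_or_eq_neg] at h
        simpa [rho, psi, Point.xMap] using h
    · rw [Finset.card_pair (by simp; norm_num)]
      simp
  | coe a =>
    obtain ⟨c, hc⟩ := IsAlgClosed.exists_pow_nat_eq a two_pos
    obtain ⟨b, hb⟩ := IsAlgClosed.exists_pow_nat_eq ((polyC u v w).eval c) two_pos
    have hb' : b ^ 2 = (polyC u v w).eval (-c) := by rw [hb, eval_polyC, eval_polyC, neg_sq]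
    refine ⟨{.affine c b hb, .affine c (-b) (by rw [neg_sq, hb]), .affine (-c) b hb',
      .affine (-c) (-b) (by rw [neg_sq, hb'])}, fun P => ?_, ?_⟩
    · cases P with
      | affine a' b' h =>
        simp only [Finset.mem_insert, Finset.mem_singleton, Point.affine.injEq, rho, psi,
          Point.xMap, OnePoint.coe_eq_coe]
        rw [← hc, sq_eq_sq_iff_eq_or_eq_neg]
        have hbb (ha : a' = c ∨ a' = -c) : b' = b ∨ b' = -b := by
          rw [← sq_eq_sq_iff_eq_or_eq_neg, h, hb]
          rcases ha with rfl | rfl <;> simp [eval_polyC]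
        tauto
      | infty b h => simp [rho, psi, Point.xMap]
    · have hmem : (a : OnePoint ℂ) ∈ ({(u : OnePoint ℂ), (v : OnePoint ℂ), (w : OnePoint ℂ)} :
          Finset (OnePoint ℂ)) ↔ b = 0 := by
        rw [← sq_eq_zero_iff (a := b), hb, eval_polyC, hc]
        simp [sub_eq_zero, or_assoc]
      have hmem' : (a : OnePoint ℂ) ∈ ({((0 : ℂ) : OnePoint ℂ), OnePoint.infty} :
          Finset (OnePoint ℂ)) ↔ c = 0 := by
        rw [← sq_eq_zero_iff (a := c), hc]
        simp
      simp only [hmem, hmem']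
      by_cases hc0 : c = 0
      · subst hc0
        have hb0 := affine_zero_ne_zero hu hv hw hb
        simp [hb0, neg_eq_self, self_eq_neg]
      · by_cases hb0 : b = 0
        · subst hb0
          simp [hc0, self_eq_neg]
        · simp [hc0, hb0, neg_eq_self, self_eq_neg]

theorem encard_rho_preimage (hu : u ≠ 0) (hv : v ≠ 0) (hw : w ≠ 0)
    (huv : u ≠ v) (huw : u ≠ w) (hvw : v ≠ w) {I : Set (OnePoint ℂ)}
    (huI : (u : OnePoint ℂ) ∈ I) (hvI : (v : OnePoint ℂ) ∈ I) (hwI : (w : OnePoint ℂ) ∈ I) :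
    (rho (u := u) (v := v) (w := w) ⁻¹' I).encard + 6 +
      2 * (I ∩ {((0 : ℂ) : OnePoint ℂ), OnePoint.infty}).encard = 4 * I.encard := by
  classical
  by_cases hI : I.Finite
  · choose F hF hcard using exists_finset_eq_rho_fiber hu hv hw
    lift I to Finset (OnePoint ℂ) using hI
    have hT : rho (u := u) (v := v) (w := w) ⁻¹' I = (I.biUnion F : Finset _) := by
      ext P; simp [hF]
    have hB : (I : Set (OnePoint ℂ)) ∩ {((0 : ℂ) : OnePoint ℂ), OnePoint.infty} =
        (I ∩ {((0 : ℂ) : OnePoint ℂ), OnePoint.infty} : Finset _) := by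
      simp
    -- These three fibers lose two points each, which is the constant `6`.
    have hA : (I ∩ {(u : OnePoint ℂ), (v : OnePoint ℂ), (w : OnePoint ℂ)}).card = 3 := by
      rw [Finset.inter_eq_right.2 (by
        simp only [Finset.insert_subset_iff, Finset.singleton_subset_iff]
        exact ⟨huI, hvI, hwI⟩)]
      exact Finset.card_eq_three.2 ⟨u, v, w, by simpa using huv, by simpa using huw,
        by simpa using hvw, rfl⟩
    rw [hT, hB, Set.encard_coe_eq_coe_finsetCard, Set.encard_coe_eq_coe_finsetCard,
      Set.encard_coe_eq_coe_finsetCard, Finset.card_biUnion]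
    · have := Finset.sum_congr (rfl : I = I) fun z _ => hcard z
      rw [Finset.sum_add_distrib, Finset.sum_add_distrib, ← Finset.mul_sum, ← Finset.mul_sum,
        Finset.sum_boole, Finset.sum_boole, Finset.filter_mem_eq_inter, Finset.filter_mem_eq_inter,
        hA, Finset.sum_const, smul_eq_mul, mul_comm _ 4] at this
      exact_mod_cast this
    · intro z _ z' _ hzz
      refine Finset.disjoint_left.2 fun P hP hP' => ?_
      exact hzz (((hF z P).1 hP).symm.trans ((hF z' P).1 hP'))
  -- For infinite `I` the preimage is infinite by surjectivity, and both sides are `⊤`.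
  · have hT : (rho (u := u) (v := v) (w := w) ⁻¹' I).Infinite := fun hfin =>
      hI (by simpa [Set.image_preimage_eq I rho_surjective] using hfin.image rho)
    rw [hT.encard_eq, Set.Infinite.encard_eq hI]
    simp

end Counting

end DoubleCover

end

theorem mainTheorem7 (u v w : ℂ) (hu : u ≠ 0) (hv : v ≠ 0) (hw : w ≠ 0)
    (huv : u ≠ v) (huw : u ≠ w) (hvw : v ≠ w)
    (O : DoubleCover.Point (DoubleCover.polyE u v w) 1)
    (hO : O ∈ DoubleCover.Point.ramification (DoubleCover.polyE u v w) 1)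
    (O' : DoubleCover.Point (DoubleCover.polyE' u v w) 1)
    (hO' : O' ∈ DoubleCover.Point.ramification (DoubleCover.polyE' u v w) 1) :
    (∀ T : Set (DoubleCover.Point (DoubleCover.polyC u v w) 2),
      DoubleCover.IsHyperellipticTorsionPacket T ↔
        T = DoubleCover.rho ⁻¹' DoubleCover.commonTorsion O O') ∧
    (∀ T : Set (DoubleCover.Point (DoubleCover.polyC u v w) 2),
      DoubleCover.IsHyperellipticTorsionPacket T →
        T.encard + 6 + 2 * (DoubleCover.commonTorsion O O' ∩
            {((0 : ℂ) : OnePoint ℂ), OnePoint.infty}).encard =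
          4 * (DoubleCover.commonTorsion O O').encard) := by
  have h := DoubleCover.isHyperellipticTorsionPacket_iff_eq_preimage hu hv hw huv huw hvw hO hO'
  refine ⟨h, fun T hT => ?_⟩
  rw [(h T).1 hT]
  have hmem {a : ℂ} := DoubleCover.coe_mem_commonTorsion (a := a) hu hv hw huv huw hvw hO hO'
  exact DoubleCover.encard_rho_preimage hu hv hw huv huw hvw
    (hmem (by simp [DoubleCover.eval_polyE])) (hmem (by simp [DoubleCover.eval_polyE]))
    (hmem (by simp [DoubleCover.eval_polyE]))
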